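/- Let $M$ be a germ at $x=0$ of meromorphic bundle with connection, i.e. a finite-dimensional vector space over $\mathbb C\{x\}[x^{-1}]$ with an action of $\partial_x$ satisfying the Leibniz rule. Let $V^\bullet M$ denote its Deligne filtration: the unique exhaustive decreasing filtration indexed by $\mathbb R$, with discrete jumps, by $\mathbb C\{x\}\langle x\partial_x\rangle$-submodules of finite type, such that $x V^bM=V^{b+1}M$ and such that $V^bM/V^{>b}M$ is finite-dimensional over $\mathbb C$ with all eigenvalues of $x\partial_x$ having real part $b$ (where $V^{>b}=\bigcup_{b'>b}V^{b'}$). The Deligne filtration of a finite-dimensional $\mathbb C((y))$-vector space with connection is defined in the same way, with $\mathbb C[[y]]$ and $y\partial_y$ in place of $\mathbb C\{x\}$ and $x\partial_x$. Let $q\ge 1$ and let $\pi:y\mapsto x=y^q$ be a ramification such that the formalized pull-back $\widehat N=\mathbb C((y))\otimes_{\mathbb C\{x\}[x^{-1}]}M$ (on which $y\partial_y$ acts by $y\partial_y(g\otimes m)=yg'\otimes m+g\otimes q\,x\partial_xm$) admits a decomposition $\widehat N\simeq\bigoplus_{\varphi\in\Phi}(E^\varphi\otimes R_\varphi)$, with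 $\Phi\subset y^{-1}\mathbb C[y^{-1}]$ finite, $E^\varphi=(\mathbb C((y)),d+d\varphi)$, and each $R_\varphi$ a finite-dimensional $\mathbb C((y))$-vector space with a regular singular connection. For $b\in\mathbb R$ put $P^b(\widehat N)=\bigoplus_{\varphi\in\Phi}(E^\varphi\otimes V^bR_\varphi)$, let $P^b(M)=\{m\in M : 1\otimes m\in P^{qb}(\widehat N)\}$ be the canonical parabolic filtration of $M$ (equivalently, the $\mathbb Z/q\mathbb Z$-invariants of $P^{qb}(\widehat N)\cap\pi^+M$, where $(\pi^+M)^{\mathbb Z/q\mathbb Z}$ is identified with $M$), and put $P^{>b}(M)=\bigcup_{b'>b}P^{b'}(M)$. Then the minimal extension $M_{\min}:=\mathbb C\{x\}\langle\partial_x\rangle\cdot V^{>-1}(M)$ satisfies $M_{\min}=\mathbb C\{x\}\langle\partial_x\rangle\cdot P^{>-1}(M)$. -/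

import Mathlib

open scoped LaurentSeries PowerSeries TensorProduct

noncomputable section

namespace MeroConn

/-! ### Formal and convergent Laurent series -/

/-- The field `ℂ((x))` of formal Laurent series (a copy of Mathlib's `ℂ⸨X⸩`, on which the
`ℂ`-algebra structure is the coefficientwise one). -/
def Laurent : Type := ℂ⸨X⸩

instance : Field Laurent := inferInstanceAs (Field ℂ⸨X⸩)

instance : Algebra ℂ Laurent := HahnSeries.instAlgebra

/-- The inclusion `ℂ[[x]] → ℂ((x))`. -/
def ofPS : ℂ⟦X⟧ →ₐ[ℂ] Laurent := HahnSeries.ofPowerSeriesAlg ℤ ℂ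

/-- The coefficient of `x ^ n`. -/
def Laurent.coeff (f : Laurent) (n : ℤ) : ℂ := HahnSeries.coeff (f : ℂ⸨X⸩) n

@[ext]
theorem Laurent.ext {f g : Laurent} (h : ∀ n, f.coeff n = g.coeff n) : f = g :=
  HahnSeries.ext (funext h)

/-- The coordinate `x`. -/
def Laurent.x : Laurent := ofPS PowerSeries.X

/-- The derivation `d/dx` of `ℂ((x))`. -/
def Laurent.deriv : Laurent →ₗ[ℂ] Laurent where
  toFun f := LaurentSeries.derivative ℂ (f : ℂ⸨X⸩)
  map_add' f g := map_add (LaurentSeries.derivative ℂ) (f : ℂ⸨X⸩) g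
  map_smul' c f := map_smul (LaurentSeries.derivative ℂ) c (f : ℂ⸨X⸩)

/-- The derivation `x d/dx` of `ℂ((x))`. -/
def Laurent.euler : Laurent →ₗ[ℂ] Laurent :=
  LinearMap.mulLeft ℂ Laurent.x ∘ₗ Laurent.deriv

theorem Laurent.coeff_add (f g : Laurent) (n : ℤ) : (f + g).coeff n = f.coeff n + g.coeff n :=
  rfl

theorem Laurent.x_eq : Laurent.x = (HahnSeries.single 1 1 : ℂ⸨X⸩) :=
  HahnSeries.ofPowerSeries_X

theorem Laurent.coeff_euler (f : Laurent) (n : ℤ) : f.euler.coeff n = n * f.coeff n := by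
  have h : f.euler.coeff n =
      HahnSeries.coeff ((HahnSeries.single 1 1 : ℂ⸨X⸩) * LaurentSeries.derivative ℂ (f : ℂ⸨X⸩))
        ((n - 1) + 1) := by
    rw [sub_add_cancel]
    change HahnSeries.coeff (Laurent.x * _ : Laurent) n = _
    rw [Laurent.x_eq]; rfl
  rw [h, HahnSeries.coeff_single_mul_add, one_mul]
  refine (LaurentSeries.hasseDeriv_coeff (R := ℂ) 1 (f : ℂ⸨X⸩) (n - 1)).trans ?_
  simp [Laurent.coeff]

theorem Laurent.euler_mul (f g : Laurent) : (f * g).euler = f.euler * g + f * g.euler := by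
  have hf : HahnSeries.support (f.euler : ℂ⸨X⸩) ⊆ HahnSeries.support (f : ℂ⸨X⸩) := by
    intro n hn h0
    exact hn (by change f.euler.coeff n = 0; rw [coeff_euler]; change f.coeff n = 0 at h0; simp [h0])
  have hg : HahnSeries.support (g.euler : ℂ⸨X⸩) ⊆ HahnSeries.support (g : ℂ⸨X⸩) := by
    intro n hn h0
    exact hn (by change g.euler.coeff n = 0; rw [coeff_euler]; change g.coeff n = 0 at h0; simp [h0])
  ext n
  rw [coeff_euler, coeff_add]
  have e1 : (f * g).coeff n = _ := HahnSeries.coeff_mul (x := (f : ℂ⸨X⸩)) (y := (g : ℂ⸨X⸩)) (a := n)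
  have e2 : (f.euler * g).coeff n = _ := HahnSeries.coeff_mul_left' (x := (f.euler : ℂ⸨X⸩))
    (y := (g : ℂ⸨X⸩)) (a := n) (HahnSeries.isPWO_support _) hf
  have e3 : (f * g.euler).coeff n = _ := HahnSeries.coeff_mul_right' (x := (f : ℂ⸨X⸩))
    (y := (g.euler : ℂ⸨X⸩)) (a := n) (HahnSeries.isPWO_support _) hg
  rw [e1, e2, e3, Finset.mul_sum, ← Finset.sum_add_distrib]
  refine Finset.sum_congr rfl fun p hp => ?_
  have hp' := (Finset.mem_antidiagonal.1 hp).2.2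
  have a1 : HahnSeries.coeff (f.euler : ℂ⸨X⸩) p.1 = p.1 * HahnSeries.coeff (f : ℂ⸨X⸩) p.1 :=
    coeff_euler f p.1
  have a2 : HahnSeries.coeff (g.euler : ℂ⸨X⸩) p.2 = p.2 * HahnSeries.coeff (g : ℂ⸨X⸩) p.2 :=
    coeff_euler g p.2
  rw [a1, a2, ← hp']
  push_cast
  ring

/-- The ring `ℂ{x}` of convergent power series. -/
def convPS : Subalgebra ℂ ℂ⟦X⟧ where
  carrier := {f | ∃ r : ℝ, 0 < r ∧ Summable fun n : ℕ => ‖PowerSeries.coeff n f‖ * r ^ n}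
  mul_mem' := by
    rintro f g ⟨r, hr, hf⟩ ⟨s, hs, hg⟩
    have key : ∀ (h : ℂ⟦X⟧) (u v : ℝ), 0 < v → v ≤ u →
        (Summable fun n : ℕ => ‖PowerSeries.coeff n h‖ * u ^ n) →
        Summable fun n : ℕ => ‖PowerSeries.coeff n h * (v : ℂ) ^ n‖ := by
      intro h u v hv huv H
      refine Summable.of_nonneg_of_le (fun n => norm_nonneg _) (fun n => ?_) H
      rw [norm_mul, norm_pow, Complex.norm_real, Real.norm_of_nonneg hv.le]
      gcongr
    have hm : 0 < min r s := lt_min hr hs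
    refine ⟨min r s, hm, ?_⟩
    refine (summable_norm_sum_mul_antidiagonal_of_summable_norm
      (key f r _ hm (min_le_left _ _) hf) (key g s _ hm (min_le_right _ _) hg)).congr fun n => ?_
    rw [PowerSeries.coeff_mul, ← Real.norm_of_nonneg (pow_nonneg hm.le n), ← Complex.norm_real,
      ← norm_mul, Finset.sum_mul]
    congr 1
    refine Finset.sum_congr rfl fun p hp => ?_
    rw [← Finset.HasAntidiagonal.mem_antidiagonal.1 hp]
    push_cast
    ring
  add_mem' := by
    rintro f g ⟨r, hr, hf⟩ ⟨s, hs, hg⟩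
    have hm : 0 < min r s := lt_min hr hs
    refine ⟨min r s, hm, Summable.of_nonneg_of_le (fun n => by positivity) (fun n => ?_)
      (hf.add hg)⟩
    calc ‖PowerSeries.coeff n (f + g)‖ * min r s ^ n
        ≤ (‖PowerSeries.coeff n f‖ + ‖PowerSeries.coeff n g‖) * min r s ^ n := by
          rw [map_add]; gcongr; exact norm_add_le _ _
      _ ≤ ‖PowerSeries.coeff n f‖ * r ^ n + ‖PowerSeries.coeff n g‖ * s ^ n := by
          rw [add_mul]
          gcongr
          · exact min_le_left _ _
          · exact min_le_right _ _
  algebraMap_mem' c := by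
    refine ⟨1, one_pos, summable_of_ne_finset_zero (s := {0}) fun n hn => ?_⟩
    have hn' : n ≠ 0 := by simpa using hn
    rw [PowerSeries.algebraMap_apply, PowerSeries.coeff_C, if_neg hn']
    simp

theorem X_mem_convPS : (PowerSeries.X : ℂ⟦X⟧) ∈ convPS := by
  refine ⟨1, one_pos, summable_of_ne_finset_zero (s := {1}) fun n hn => ?_⟩
  have hn' : n ≠ 1 := by simpa using hn
  rw [PowerSeries.coeff_X, if_neg hn']
  simp

theorem euler_mem_convPS {f : ℂ⟦X⟧} (hf : f ∈ convPS) :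
    PowerSeries.mk (fun n => (n : ℂ) * PowerSeries.coeff n f) ∈ convPS := by
  obtain ⟨r, hr, hs⟩ := hf
  refine ⟨r / 2, by positivity, Summable.of_nonneg_of_le (fun n => by positivity) (fun n => ?_) hs⟩
  rw [PowerSeries.coeff_mk, norm_mul, Complex.norm_natCast, div_pow]
  have h2 : (n : ℝ) ≤ 2 ^ n := by exact_mod_cast Nat.lt_two_pow_self.le
  have : (n : ℝ) / 2 ^ n ≤ 1 := (div_le_one (by positivity)).2 h2
  calc (n : ℝ) * ‖PowerSeries.coeff n f‖ * (r ^ n / 2 ^ n)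
      = (n : ℝ) / 2 ^ n * (‖PowerSeries.coeff n f‖ * r ^ n) := by ring
    _ ≤ 1 * (‖PowerSeries.coeff n f‖ * r ^ n) := by gcongr
    _ = _ := one_mul _

theorem coeff_ofPS_natCast (f : ℂ⟦X⟧) (n : ℕ) : (ofPS f).coeff n = PowerSeries.coeff n f :=
  HahnSeries.ofPowerSeries_apply_coeff f n

theorem coeff_ofPS_of_neg (f : ℂ⟦X⟧) {n : ℤ} (hn : n < 0) : (ofPS f).coeff n = 0 := by
  change HahnSeries.coeff (HahnSeries.ofPowerSeries ℤ ℂ f) n = 0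
  rw [HahnSeries.ofPowerSeries_apply, HahnSeries.embDomain_of_notMem_range]
  rintro ⟨m, hm⟩
  simp at hm
  lia

theorem euler_ofPS (f : ℂ⟦X⟧) :
    (ofPS f).euler = ofPS (PowerSeries.mk fun n => (n : ℂ) * PowerSeries.coeff n f) := by
  ext n
  rw [Laurent.coeff_euler]
  rcases lt_or_ge n 0 with hn | hn
  · rw [coeff_ofPS_of_neg _ hn, coeff_ofPS_of_neg _ hn, mul_zero]
  · lift n to ℕ using hn
    rw [coeff_ofPS_natCast, coeff_ofPS_natCast, PowerSeries.coeff_mk]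
    simp

/-- The field `ℂ{x}[1/x]` of convergent Laurent series, inside `ℂ((x))`. -/
def ConvLaurent : Subalgebra ℂ Laurent where
  carrier := {f | ∃ k : ℕ, ∃ g ∈ convPS, Laurent.x ^ k * f = ofPS g}
  mul_mem' := by
    rintro f₁ f₂ ⟨k, g, hg, h⟩ ⟨l, g', hg', h'⟩
    exact ⟨k + l, g * g', mul_mem hg hg', by rw [map_mul, ← h, ← h']; ring⟩
  add_mem' := by
    rintro f₁ f₂ ⟨k, g, hg, h⟩ ⟨l, g', hg', h'⟩
    refine ⟨k + l, PowerSeries.X ^ l * g + PowerSeries.X ^ k * g',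
      add_mem (mul_mem (pow_mem X_mem_convPS _) hg) (mul_mem (pow_mem X_mem_convPS _) hg'), ?_⟩
    rw [map_add, map_mul, map_mul, map_pow, map_pow, ← h, ← h']
    change _ = Laurent.x ^ l * _ + Laurent.x ^ k * _
    ring
  algebraMap_mem' c := ⟨0, algebraMap ℂ _ c, convPS.algebraMap_mem c, by
    rw [pow_zero, one_mul, AlgHom.commutes]⟩

/-- The subring `ℂ{x}` of `ℂ{x}[1/x]`. -/
def convIntegers : Subalgebra ℂ ConvLaurent := (convPS.map ofPS).comap ConvLaurent.val

/-- The coordinate `x` as an element of `ℂ{x}[1/x]`. -/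
def ConvLaurent.x : ConvLaurent :=
  ⟨Laurent.x, 0, PowerSeries.X, X_mem_convPS, by rw [pow_zero, one_mul]; rfl⟩

theorem Laurent.x_ne_zero : Laurent.x ≠ 0 := by
  intro h
  have h1 : Laurent.x.coeff ((1 : ℕ) : ℤ) = 1 := by
    rw [Laurent.x, coeff_ofPS_natCast, PowerSeries.coeff_one_X]
  rw [h] at h1
  exact zero_ne_one h1

theorem Laurent.euler_x_pow (k : ℕ) : (Laurent.x ^ k).euler = k * Laurent.x ^ k := by
  have h1 : Laurent.x.euler = Laurent.x := by
    rw [Laurent.x, euler_ofPS]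
    congr 1
    ext n
    rw [PowerSeries.coeff_mk, PowerSeries.coeff_X]
    split_ifs with h <;> simp [h]
  induction k with
  | zero =>
    have := Laurent.euler_mul 1 1
    simp only [mul_one, one_mul, left_eq_add] at this
    simp [this]
  | succ k ih => rw [pow_succ, Laurent.euler_mul, ih, h1]; push_cast; ring

theorem deriv_mem {f : Laurent} (hf : f ∈ ConvLaurent) : f.deriv ∈ ConvLaurent := by
  obtain ⟨k, g, hg, h⟩ := hf
  refine ⟨k + 1, PowerSeries.mk (fun n => (n : ℂ) * PowerSeries.coeff n g) - k * g,
    sub_mem (euler_mem_convPS hg) (mul_mem (natCast_mem _ k) hg), ?_⟩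
  have h1 := congrArg Laurent.euler h
  rw [Laurent.euler_mul, Laurent.euler_x_pow, euler_ofPS] at h1
  rw [map_sub, ← h1, map_mul, map_natCast, ← h]
  change _ = k * Laurent.x ^ k * f + Laurent.x ^ k * (Laurent.x * f.deriv) - _
  ring

/-- The derivation `d/dx` of `ℂ{x}[1/x]`. -/
def ConvLaurent.deriv : ConvLaurent →ₗ[ℂ] ConvLaurent :=
  Laurent.deriv.restrict (p := Subalgebra.toSubmodule ConvLaurent)
    (q := Subalgebra.toSubmodule ConvLaurent) fun _ hf => deriv_mem hf

/-! ### The ramification `y ↦ x = y ^ q` -/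

/-- The field `ℂ((y))`, regarded as an extension of `ℂ{x}[1/x]` through `x = y ^ q`. -/
def Ram (_q : ℕ+) : Type := Laurent

instance (q : ℕ+) : Field (Ram q) := inferInstanceAs (Field Laurent)

instance (q : ℕ+) : Algebra ℂ (Ram q) := inferInstanceAs (Algebra ℂ Laurent)

/-- The substitution `f(x) ↦ f(y ^ q)`. -/
def ramify (q : ℕ+) : Laurent →ₐ[ℂ] Ram q :=
  HahnSeries.embDomainAlgHom (Γ := ℤ) (Γ' := ℤ) (R := ℂ) (A := ℂ)
    (AddMonoidHom.mulLeft ((q : ℕ) : ℤ))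
    (mul_right_injective₀ (by exact_mod_cast q.ne_zero))
    (fun _ _ => mul_le_mul_iff_right₀ (by exact_mod_cast q.pos))

instance (q : ℕ+) : Algebra ConvLaurent (Ram q) :=
  ((ramify q).comp ConvLaurent.val).toRingHom.toAlgebra

instance (q : ℕ+) : IsScalarTower ℂ ConvLaurent (Ram q) :=
  IsScalarTower.of_algebraMap_eq' ((ramify q).comp ConvLaurent.val).comp_algebraMap.symm

/-- The coordinate `y`. -/
def Ram.y (q : ℕ+) : Ram q := Laurent.x

/-- The subring `ℂ[[y]]` of `ℂ((y))`. -/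
def formalIntegers (q : ℕ+) : Subalgebra ℂ (Ram q) := ofPS.range

/-- The derivation `y d/dy` of `ℂ((y))`. -/
def Ram.euler (q : ℕ+) : Ram q →ₗ[ℂ] Ram q := Laurent.euler

theorem Ram.euler_mul (q : ℕ+) (f g : Ram q) :
    Ram.euler q (f * g) = Ram.euler q f * g + f * Ram.euler q g :=
  Laurent.euler_mul f g

theorem euler_ramify (q : ℕ+) (f : Laurent) :
    Ram.euler q (ramify q f) = (q : ℕ) • ramify q f.euler := by
  have hq : (q : ℕ) • ramify q f.euler = ((q : ℕ) : ℂ) • ramify q f.euler := by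
    rw [Nat.cast_smul_eq_nsmul]
  rw [hq]
  refine Laurent.ext fun n => ?_
  refine (Laurent.coeff_euler _ n).trans ?_
  change (n : ℂ) * Laurent.coeff (ramify q f) n =
    ((q : ℕ) : ℂ) * Laurent.coeff (ramify q f.euler) n
  by_cases hn : ∃ m : ℤ, n = (q : ℕ) * m
  · obtain ⟨m, rfl⟩ := hn
    have key : ∀ h : Laurent, Laurent.coeff (ramify q h) ((q : ℕ) * m) = h.coeff m := fun h =>
      HahnSeries.embDomain_coeff (a := m)
    rw [key, key, Laurent.coeff_euler]
    push_cast
    ring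
  · have key : ∀ h : Laurent, Laurent.coeff (ramify q h) n = 0 := fun h =>
      HahnSeries.embDomain_of_notMem_range (by
        rintro ⟨m, hm⟩
        exact hn ⟨m, hm.symm⟩)
    rw [key, key, mul_zero, mul_zero]

/-- The polar parts: elements of `y⁻¹ℂ[y⁻¹]`. -/
def IsPolar {q : ℕ+} (φ : Ram q) : Prop := ∀ n : ℤ, 0 ≤ n → Laurent.coeff φ n = 0

/-! ### Modules generated by differential operators, and the Deligne filtration

In this section `F` is `ℂ{x}[1/x]` or `ℂ((y))`, `A ⊆ F` is its subring `ℂ{x}` or `ℂ[[y]]`, `t` is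
the coordinate, and `θ` is the action of `t∂_t` on an `F`-vector space `E` with connection. -/

section Generic

variable {F : Type*} [CommRing F] [Algebra ℂ F] (A : Subalgebra ℂ F)
  {E : Type*} [AddCommGroup E] [Module ℂ E] [Module F E]

/-- The algebra of operators on `E` generated by the multiplications by elements of `A` and by
the operator `D`. For `D = ∂_t` (resp. `t∂_t`) this is the image of `A⟨∂_t⟩` (resp. `A⟨t∂_t⟩`)
in `End_ℂ(E)`. -/
def operators (D : Module.End ℂ E) : Subalgebra ℂ (Module.End ℂ E) :=
  Algebra.adjoin ℂ ({T | ∃ a ∈ A, ∀ m, T m = a • m} ∪ {D})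

/-- `A⟨D⟩ · S`: the left `A⟨D⟩`-submodule of `E` generated by `S`. -/
def generated (D : Module.End ℂ E) (S : Set E) : Submodule ℂ E :=
  (Submodule.span (operators A D) S).restrictScalars ℂ

/-- `V^{>b} = ⋃_{b' > b} V^{b'}` for a decreasing filtration `V`. -/
def above (V : ℝ → Submodule ℂ E) (b : ℝ) : Submodule ℂ E :=
  ⨆ b' : Set.Ioi b, V b'

/-- `V` is a Deligne filtration of `E`: an exhaustive decreasing filtration indexed by `ℝ`, with a
discrete set of jumps, by finitely generated `A⟨t∂_t⟩`-submodules, such that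
`t V^b = V^{b+1}` and such that `gr^b_V = V^b / V^{>b}` is a finite dimensional vector space on
which the eigenvalues of `t∂_t` all have real part `b`. -/
structure IsDeligneFiltration (t : F) (θ : Module.End ℂ E) (V : ℝ → Submodule ℂ E) : Prop where
  antitone : Antitone V
  exhaustive : ∀ m, ∃ b, m ∈ V b
  finite_type : ∀ b, ∃ S : Finset E, V b = generated A θ S
  shift : ∀ b m, m ∈ V (b + 1) ↔ ∃ n ∈ V b, m = t • n
  /-- Off a finite union of classes `a + ℤ` the filtration does not jump: `V^b = V^c` as soon as
  no point `a + k` lies in `[b, c[`. -/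
  discrete : ∃ J : Finset ℝ, ∀ b c, b ≤ c →
    (∀ a ∈ J, ∀ k : ℤ, a + k ∉ Set.Ico b c) → V b = V c
  finite_dim : ∀ b, Module.Finite ℂ (V b ⧸ (above V b).submoduleOf (V b))
  /-- If the class of `m` in `gr^b_V` is a nonzero eigenvector of `t∂_t` for `β`,
  then `Re β = b`. -/
  eigenvalue : ∀ b, ∀ m ∈ V b, m ∉ above V b →
    ∀ β : ℂ, θ m - β • m ∈ above V b → β.re = b

/-- The Deligne filtration `V^b E`. A filtration as in `IsDeligneFiltration` is unique, so that
the supremum over all of them is the filtration itself. -/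
def deligne (t : F) (θ : Module.End ℂ E) (b : ℝ) : Submodule ℂ E :=
  ⨆ (V : ℝ → Submodule ℂ E) (_ : IsDeligneFiltration A t θ V), V b

/-- The singularity of the connection is regular: there is a lattice (a finitely generated
`A`-submodule that generates `E` over `F`) that is stable under `t∂_t`. -/
def IsRegularSingular (θ : Module.End ℂ E) : Prop :=
  ∃ L : Submodule A E, L.FG ∧ Submodule.span F (L : Set E) = ⊤ ∧ ∀ m ∈ L, θ m ∈ L

end Generic

/-! ### Germs of meromorphic connections -/

/-- A connection on a `ℂ{x}[1/x]`-vector space `M`, given by the action of `∂_x`. -/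
structure Connection (M : Type*) [AddCommGroup M] [Module ℂ M] [Module ConvLaurent M] where
  /-- The action of `∂_x`. -/
  d : Module.End ℂ M
  leibniz : ∀ (f : ConvLaurent) (m : M), d (f • m) = ConvLaurent.deriv f • m + f • d m

namespace Connection

variable {M : Type*} [AddCommGroup M] [Module ℂ M] [Module ConvLaurent M]
  [IsScalarTower ℂ ConvLaurent M] (C : Connection M)

/-- The action of `x∂_x` on `M`. -/
def euler : Module.End ℂ M where
  toFun m := ConvLaurent.x • C.d m
  map_add' m n := by rw [map_add, smul_add]
  map_smul' c m := by rw [map_smul, smul_comm, RingHom.id_apply]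

/-- The Deligne filtration `V^b M`. -/
def V (b : ℝ) : Submodule ℂ M := deligne convIntegers ConvLaurent.x C.euler b

/-- `ℂ{x}⟨∂_x⟩ · S` for a subset `S` of `M`. -/
def DSpan (S : Set M) : Submodule ℂ M := generated convIntegers C.d S

/-- The minimal extension `ℂ{x}⟨∂_x⟩ · V^{>-1} M`. -/
def minimalExtension : Submodule ℂ M := C.DSpan (above C.V (-1))

/-- The action of `y∂_y` on the formalized pull-back `ℂ((y)) ⊗ M` by `x = y ^ q`:
`g ⊗ m ↦ (y dg/dy) ⊗ m + g ⊗ q (x∂_x m)`. -/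
def pullbackEuler (q : ℕ+) : Module.End ℂ (Ram q ⊗[ConvLaurent] M) :=
  let B : Ram q →+ M →+ Ram q ⊗[ConvLaurent] M :=
    AddMonoidHom.mk' (fun g => AddMonoidHom.mk'
      (fun m => Ram.euler q g ⊗ₜ m + g ⊗ₜ ((q : ℕ) • C.euler m))
      (fun m n => by rw [map_add, smul_add, TensorProduct.tmul_add, TensorProduct.tmul_add]; abel))
      (fun g h => by
        ext m
        simp only [AddMonoidHom.mk'_apply, AddMonoidHom.add_apply, map_add, TensorProduct.add_tmul]
        abel)
  let T : Ram q ⊗[ConvLaurent] M →+ Ram q ⊗[ConvLaurent] M :=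
    TensorProduct.liftAddHom B (by
      intro f g m
      have h1 : Ram.euler q (f • g) =
          ((q : ℕ) • (ConvLaurent.x * ConvLaurent.deriv f)) • g + f • Ram.euler q g := by
        rw [Algebra.smul_def, Ram.euler_mul, ← Algebra.smul_def, Algebra.smul_def]
        congr 2
        rw [map_nsmul]
        exact euler_ramify q f
      have h2 : C.euler (f • m) = (ConvLaurent.x * ConvLaurent.deriv f) • m + f • C.euler m := by
        change ConvLaurent.x • C.d (f • m) = _ + f • (ConvLaurent.x • C.d m)
        rw [C.leibniz, smul_add, mul_smul, smul_comm ConvLaurent.x f]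
      change Ram.euler q (f • g) ⊗ₜ[ConvLaurent] m + (f • g) ⊗ₜ[ConvLaurent] ((q : ℕ) • C.euler m)
        = Ram.euler q g ⊗ₜ[ConvLaurent] (f • m) + g ⊗ₜ[ConvLaurent] ((q : ℕ) • C.euler (f • m))
      rw [h1, h2, TensorProduct.add_tmul, smul_add, TensorProduct.tmul_add, ← smul_assoc,
        smul_comm (q : ℕ) f, ← TensorProduct.smul_tmul f g,
        ← TensorProduct.smul_tmul _ g, TensorProduct.smul_tmul f (Ram.euler q g)]
      abel)
  { T with
    map_smul' := fun c n => by
      change T (c • n) = c • T n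
      induction n using TensorProduct.induction_on with
      | zero => simp
      | tmul g m =>
        rw [TensorProduct.smul_tmul']
        change Ram.euler q (c • g) ⊗ₜ[ConvLaurent] m + (c • g) ⊗ₜ[ConvLaurent] _ =
          c • (Ram.euler q g ⊗ₜ[ConvLaurent] m + g ⊗ₜ[ConvLaurent] _)
        rw [map_smul, smul_add, TensorProduct.smul_tmul', TensorProduct.smul_tmul']
      | add a b ha hb => rw [smul_add, map_add, ha, hb, map_add, smul_add] }

theorem pullbackEuler_tmul (q : ℕ+) (g : Ram q) (m : M) :
    C.pullbackEuler q (g ⊗ₜ m) = Ram.euler q g ⊗ₜ m + g ⊗ₜ ((q : ℕ) • C.euler m) :=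
  rfl

/-- The operator `y∂_y - yφ'` on a subspace `W` of `ℂ((y)) ⊗ M` stable by the connection. -/
def twistedEuler {q : ℕ+} (W : Submodule (Ram q) (Ram q ⊗[ConvLaurent] M))
    (hW : ∀ n ∈ W, C.pullbackEuler q n ∈ W) (φ : Ram q) : Module.End ℂ W where
  toFun n := ⟨C.pullbackEuler q n - Ram.euler q φ • (n : Ram q ⊗[ConvLaurent] M),
    sub_mem (hW _ n.2) (W.smul_mem _ n.2)⟩
  map_add' m n := by
    ext
    simp only [Submodule.coe_add, map_add, smul_add]
    abel
  map_smul' c n := by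
    ext
    change C.pullbackEuler q (c • (n : Ram q ⊗[ConvLaurent] M)) -
      Ram.euler q φ • c • (n : Ram q ⊗[ConvLaurent] M) = c • (_ - _)
    rw [map_smul, smul_comm _ c, smul_sub]

/-- An elementary formal model of the pull-back of `M` by `x = y ^ q`: a decomposition of
`ℂ((y)) ⊗ M` into a direct sum, indexed by a finite set `Φ` of `φ ∈ y⁻¹ℂ[y⁻¹]`, of subspaces
stable by the connection and isomorphic to `E^φ ⊗ R_φ` with `R_φ` regular. Since
`E^φ = (ℂ((y)), d + dφ)`, the space `E^φ ⊗ R_φ` is the vector space `R_φ` on which `y∂_y` is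
replaced by `y∂_y + yφ'`. Thus `R_φ` is the `φ`-summand with the operator `y∂_y - yφ'`. -/
structure ElementaryModel (q : ℕ+) where
  /-- The exponential factors. -/
  Φ : Finset (Ram q)
  polar : ∀ φ ∈ Φ, IsPolar φ
  /-- The summand `E^φ ⊗ R_φ`. -/
  summand : Φ → Submodule (Ram q) (Ram q ⊗[ConvLaurent] M)
  independent : iSupIndep summand
  iSup_eq_top : ⨆ φ, summand φ = ⊤
  stable : ∀ φ, ∀ n ∈ summand φ, C.pullbackEuler q n ∈ summand φ
  regular : ∀ φ : Φ, IsRegularSingular (E := summand φ) (formalIntegers q)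
    (C.twistedEuler (summand φ) (stable φ) φ)

namespace ElementaryModel

variable {C} {q : ℕ+} (S : C.ElementaryModel q)

/-- The Deligne filtration `V^b R_φ`. -/
def regularV (φ : S.Φ) (b : ℝ) : Submodule ℂ (S.summand φ) :=
  deligne (E := S.summand φ) (formalIntegers q) (Ram.y q)
    (C.twistedEuler (S.summand φ) (S.stable φ) φ) b

/-- The filtration `P^b = ⨁_φ (E^φ ⊗ V^b R_φ)` of `ℂ((y)) ⊗ M`. -/
def formalParabolic (b : ℝ) : Submodule ℂ (Ram q ⊗[ConvLaurent] M) :=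
  ⨆ φ, (S.regularV φ b).map ((S.summand φ).subtype.restrictScalars ℂ)

/-- The canonical parabolic filtration of `M`: `P^b M` is the set of the `m ∈ M` such that `1 ⊗ m`
lies in `P^{qb}(ℂ((y)) ⊗ M)`. Here `M` is identified, by `m ↦ 1 ⊗ m`, with the space of
`ℤ/qℤ`-invariants of its pull-back by `x = y ^ q`. -/
def parabolic (b : ℝ) : Submodule ℂ M :=
  (S.formalParabolic (q * b)).comap
    ((TensorProduct.mk ConvLaurent (Ram q) M 1).restrictScalars ℂ)

end ElementaryModel

end Connection

end MeroConn

end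

/-!
The key point is that `P^b M` generates `V^b M` over `ℂ{x}⟨x∂_x⟩`, and `x∂_x ∈ ℂ{x}⟨∂_x⟩`.

Let `V'^b` consist of the `m ∈ M` such that the component of `1 ⊗ m` in the regular part `R_0` lies
in `V^{qb} R_0`. It is stable by `x∂_x` and contains `P^b M`, hence also `U = ℂ{x}⟨x∂_x⟩ · P^b M`.
On a summand `E^φ ⊗ R_φ` with `φ ≠ 0` the operator `y∂_y` strictly lowers the `y`-adic order, so
that a `y∂_y`-stable `ℂ[[y]]`-submodule which generates `ℂ((y)) ⊗ M` over `ℂ((y))`, for instance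
`ℂ[[y]] · (1 ⊗ U)`, contains the whole irregular part. Given `m ∈ V'^b`, write `1 ⊗ m = r + i` with
`r` regular and `i` irregular, and apply the `ℂ((x))`-linear projector `e` of `ℂ((y))` on `ℂ((x))`:
it commutes with `y∂_y`, fixes `1 ⊗ m` and preserves the regular and irregular parts. Thus
`e r ∈ P^{qb}`, while `e i ∈ ℂ[[x]] · (1 ⊗ U)`. Truncating the power series coefficients of the
latter shows that `1 ⊗ m` is congruent to an element of `1 ⊗ U` modulo `P^{qb}`, so `V'^b = U`.

As a consequence `V'^b` is of finite type, so that `V'` is a Deligne filtration of `M`, and `V' = V`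
by uniqueness.
-/

open scoped Polynomial Topology
open Polynomial (aeval)
open Finset.HasAntidiagonal (antidiagonal mem_antidiagonal)

noncomputable section

namespace MeroConn

/-! ### Modules generated by operators -/

section Generated

variable {F : Type*} [CommRing F] [Algebra ℂ F] {A : Subalgebra ℂ F}
  {E : Type*} [AddCommGroup E] [Module ℂ E] [Module F E] {D : Module.End ℂ E}

theorem subset_generated (D : Module.End ℂ E) (S : Set E) : S ⊆ generated A D S :=
  Submodule.subset_span

theorem apply_mem_generated {S : Set E} {m : E} (hm : m ∈ generated A D S) :
    D m ∈ generated A D S :=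
  have hD : D ∈ operators A D := Algebra.subset_adjoin (Or.inr rfl)
  Submodule.smul_mem (Submodule.span (operators A D) S) ⟨D, hD⟩ hm

theorem operators_apply_mem {W : Submodule ℂ E} (hA : ∀ a ∈ A, ∀ m ∈ W, a • m ∈ W)
    (hD : ∀ m ∈ W, D m ∈ W) {T : Module.End ℂ E} (hT : T ∈ operators A D) :
    ∀ m ∈ W, T m ∈ W := by
  induction hT using Algebra.adjoin_induction with
  | mem T h =>
    rcases h with ⟨a, ha, hTa⟩ | rfl
    · exact fun m hm => hTa m ▸ hA a ha m hm
    · exact hD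
  | algebraMap c => exact fun m hm => W.smul_mem c hm
  | add _ _ _ _ hS hT => exact fun m hm => add_mem (hS m hm) (hT m hm)
  | mul _ _ _ _ hS hT => exact fun m hm => hS _ (hT m hm)

theorem generated_le {S : Set E} {W : Submodule ℂ E} (hS : S ⊆ W)
    (hA : ∀ a ∈ A, ∀ m ∈ W, a • m ∈ W) (hD : ∀ m ∈ W, D m ∈ W) : generated A D S ≤ W := by
  intro m hm
  change m ∈ Submodule.span (operators A D) S at hm
  induction hm using Submodule.span_induction with
  | mem m h => exact hS h
  | zero => exact zero_mem W
  | add m n _ _ hm hn => exact add_mem hm hn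
  | smul T m _ hm => exact operators_apply_mem hA hD T.2 m hm

theorem generated_mono {S S' : Set E} (h : S ⊆ S') : generated A D S ≤ generated A D S' :=
  fun _ hm => Submodule.span_mono h hm

variable [SMulCommClass F ℂ E]

theorem smul_mem_generated {S : Set E} {a : F} (ha : a ∈ A) {m : E}
    (hm : m ∈ generated A D S) : a • m ∈ generated A D S := by
  let T : Module.End ℂ E := DistribSMul.toLinearMap ℂ E a
  have hT : T ∈ operators A D := Algebra.subset_adjoin (Or.inl ⟨a, ha, fun _ => rfl⟩)
  exact Submodule.smul_mem (Submodule.span (operators A D) S) ⟨T, hT⟩ hm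

theorem span_subset_generated (D : Module.End ℂ E) (S : Set E) :
    (Submodule.span A S : Set E) ⊆ generated A D S := by
  intro m hm
  induction hm using Submodule.span_induction with
  | mem m hm => exact subset_generated D S hm
  | zero => exact zero_mem (generated A D S)
  | add m n _ _ hm hn => exact add_mem hm hn
  | smul a m _ hm => exact smul_mem_generated a.2 hm

theorem generated_eq_generated_of_coe_eq_span (D : Module.End ℂ E) {W : Submodule ℂ E} {S : Set E}
    (h : (W : Set E) = Submodule.span A S) : generated A D (W : Set E) = generated A D S :=
  le_antisymm (generated_le (h ▸ span_subset_generated D S)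
    (fun _ ha _ => smul_mem_generated ha) fun _ => apply_mem_generated)
    (generated_mono (h ▸ Submodule.subset_span))

end Generated

section Above

variable {E : Type*} [AddCommGroup E] [Module ℂ E] {V : ℝ → Submodule ℂ E}

theorem mem_above (hV : Antitone V) {b : ℝ} {m : E} : m ∈ above V b ↔ ∃ c > b, m ∈ V c := by
  have : Nonempty (Set.Ioi b) := Set.nonempty_Ioi.to_subtype
  have hd : Directed (· ≤ ·) fun c : Set.Ioi b => V c :=
    (hV.comp_monotone (Subtype.mono_coe _)).directed_le
  simp [above, Submodule.mem_iSup_of_directed _ hd]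

theorem le_above (V : ℝ → Submodule ℂ E) {b c : ℝ} (h : b < c) : V c ≤ above V b :=
  le_iSup (fun c : Set.Ioi b => V c) ⟨c, h⟩

theorem above_le {W : Submodule ℂ E} {b : ℝ} (h : ∀ c > b, V c ≤ W) : above V b ≤ W :=
  iSup_le fun c => h c c.2

theorem above_mono {V' : ℝ → Submodule ℂ E} (h : ∀ b, V b ≤ V' b) (b : ℝ) :
    above V b ≤ above V' b :=
  iSup_mono fun c => h c

theorem above_const (W : Submodule ℂ E) (b : ℝ) : above (fun _ => W) b = W :=
  have : Nonempty (Set.Ioi b) := Set.nonempty_Ioi.to_subtype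
  iSup_const

end Above

/-! ### Polynomials in an operator -/

section Polynomials

variable {E : Type*} [AddCommGroup E] [Module ℂ E] {θ : Module.End ℂ E} {V W : Submodule ℂ E}

theorem map_aeval_apply {E' : Type*} [AddCommGroup E'] [Module ℂ E'] {θ' : Module.End ℂ E'}
    (f : E →ₗ[ℂ] E') (h : ∀ m, f (θ m) = θ' (f m)) (Q : ℂ[X]) (m : E) :
    f (aeval θ Q m) = aeval θ' Q (f m) := by
  induction Q using Polynomial.induction_on generalizing m with
  | C c => simp
  | add P Q hP hQ => simp [hP, hQ]
  | monomial n c ih => simpa [pow_succ, h] using ih (θ m)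

theorem mem_of_aeval_apply_mem {Q : ℂ[X]} (hQ : Q ≠ 0)
    (hroots : ∀ β, Q.IsRoot β → ∀ m, θ m - β • m ∈ W → m ∈ W) {m : E} (hm : aeval θ Q m ∈ W) :
    m ∈ W := by
  generalize hn : Q.natDegree = n
  induction n generalizing Q m with
  | zero =>
    obtain ⟨c, rfl⟩ := Polynomial.natDegree_eq_zero.1 hn
    rw [Polynomial.aeval_C, Module.algebraMap_end_apply] at hm
    exact (W.smul_mem_iff (Polynomial.C_ne_zero.1 hQ)).1 hm
  | succ n ih =>
    obtain ⟨β, hβ⟩ := IsAlgClosed.exists_root Q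
      (Polynomial.degree_ne_of_natDegree_ne (n := 0) (by lia))
    obtain ⟨R, rfl⟩ := Polynomial.dvd_iff_isRoot.2 hβ
    have hR : R ≠ 0 := right_ne_zero_of_mul hQ
    have hRm : aeval θ R m ∈ W := hroots β hβ _ (by simpa [sub_smul] using hm)
    refine ih hR (fun γ hγ => hroots γ (hγ.dvd (dvd_mul_left _ _))) hRm ?_
    rw [Polynomial.natDegree_mul (Polynomial.X_sub_C_ne_zero β) hR,
      Polynomial.natDegree_X_sub_C] at hn
    lia

theorem exists_annihilating_quotient (hV : ∀ m ∈ V, θ m ∈ V) (hW : ∀ m ∈ W, θ m ∈ W)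
    [Module.Finite ℂ (V ⧸ W.submoduleOf V)] :
    ∃ Q : ℂ[X], Q ≠ 0 ∧ (∀ m ∈ V, aeval θ Q m ∈ W) ∧
      ∀ β, Q.IsRoot β → ∃ m ∈ V, m ∉ W ∧ θ m - β • m ∈ W := by
  let θV : Module.End ℂ V := θ.restrict hV
  let θq : Module.End ℂ (V ⧸ W.submoduleOf V) :=
    (W.submoduleOf V).mapQ (W.submoduleOf V) θV fun m hm => hW _ hm
  refine ⟨minpoly ℂ θq, minpoly.ne_zero (Algebra.IsIntegral.isIntegral θq), fun m hm => ?_,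
    fun β hβ => ?_⟩
  · have hq := map_aeval_apply (θ' := θq) (W.submoduleOf V).mkQ (fun _ => rfl)
      (minpoly ℂ θq) ⟨m, hm⟩
    rw [minpoly.aeval] at hq
    have hmem : V.subtype (aeval θV (minpoly ℂ θq) ⟨m, hm⟩) ∈ W :=
      Submodule.mem_comap.1 ((Submodule.Quotient.mk_eq_zero (W.submoduleOf V)).1 hq)
    rwa [map_aeval_apply (θ' := θ) V.subtype fun _ => rfl] at hmem
  · obtain ⟨v, hv⟩ := (Module.End.hasEigenvalue_of_isRoot hβ).exists_hasEigenvector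
    obtain ⟨m, rfl⟩ := Submodule.Quotient.mk_surjective _ v
    refine ⟨m, m.2, fun h => hv.2 ((Submodule.Quotient.mk_eq_zero _).2 h), ?_⟩
    have heigen := hv.apply_eq_smul
    change Submodule.Quotient.mk (θV m) = β • Submodule.Quotient.mk m at heigen
    rwa [← Submodule.Quotient.mk_smul, Submodule.Quotient.eq] at heigen

theorem exists_aeval_mem_of_isRoot_of_isRoot (hW : ∀ m ∈ W, θ m ∈ W) {P Q : ℂ[X]} (hP : P ≠ 0)
    {m : E} (hPm : aeval θ P m ∈ W) (hQm : aeval θ Q m ∈ W) :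
    ∃ G : ℂ[X], G ≠ 0 ∧ (∀ β, G.IsRoot β → P.IsRoot β ∧ Q.IsRoot β) ∧ aeval θ G m ∈ W := by
  refine ⟨EuclideanDomain.gcd P Q, fun h => hP (EuclideanDomain.gcd_eq_zero_iff.1 h).1,
    fun β hβ => ⟨hβ.dvd (EuclideanDomain.gcd_dvd_left P Q),
      hβ.dvd (EuclideanDomain.gcd_dvd_right P Q)⟩, ?_⟩
  rw [EuclideanDomain.gcd_eq_gcd_ab, mul_comm P, mul_comm Q, map_add, map_mul, map_mul]
  exact add_mem (Polynomial.aeval_apply_smul_mem_of_le_comap hPm _ θ hW)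
    (Polynomial.aeval_apply_smul_mem_of_le_comap hQm _ θ hW)

end Polynomials

/-- `Q` is a nonzero polynomial whose roots all have real part at least `b`. Such polynomials in
`t∂_t` act nilpotently exactly on the part of order at least `b` of a Deligne filtration. -/
def RootsGE (b : ℝ) (Q : ℂ[X]) : Prop :=
  Q ≠ 0 ∧ ∀ β, Q.IsRoot β → b ≤ β.re

namespace RootsGE

variable {b c : ℝ} {P Q : ℂ[X]}

theorem one (b : ℝ) : RootsGE b 1 :=
  ⟨one_ne_zero, fun β hβ => by simp [Polynomial.IsRoot] at hβ⟩

theorem mul (hP : RootsGE b P) (hQ : RootsGE b Q) : RootsGE b (P * Q) :=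
  ⟨mul_ne_zero hP.1 hQ.1, fun β hβ => (Polynomial.root_mul.1 hβ).elim (hP.2 β) (hQ.2 β)⟩

theorem mono (hbc : b ≤ c) (hQ : RootsGE c Q) : RootsGE b Q :=
  ⟨hQ.1, fun β hβ => hbc.trans (hQ.2 β hβ)⟩

theorem X_sub_C (β : ℂ) : RootsGE β.re (Polynomial.X - Polynomial.C β) :=
  ⟨Polynomial.X_sub_C_ne_zero β, fun γ hγ => by rw [Polynomial.root_X_sub_C.1 hγ]⟩

theorem comp_X_add_C (hQ : RootsGE b Q) (a : ℂ) :
    RootsGE (b - a.re) (Q.comp (Polynomial.X + Polynomial.C a)) := by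
  refine ⟨mt Polynomial.comp_X_add_C_eq_zero_iff.1 hQ.1, fun β hβ => ?_⟩
  have hroot : Q.IsRoot (β + a) := by simpa [Polynomial.IsRoot, Polynomial.eval_comp] using hβ
  simpa [sub_le_iff_le_add] using hQ.2 _ hroot

end RootsGE

/-! ### Uniqueness of the Deligne filtration -/

theorem exists_gt_forall_add_intCast_notMem_Ioo (a b : ℝ) :
    ∃ u > b, ∀ k : ℤ, a + k ∉ Set.Ioo b u := by
  refine ⟨a + ⌊b - a⌋ + 1, by linarith [Int.lt_floor_add_one (b - a)], fun k hk => ?_⟩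
  have hlt : ⌊b - a⌋ < k := Int.floor_lt.2 (by linarith [hk.1])
  have hgt : k < ⌊b - a⌋ + 1 := by
    exact_mod_cast (by linarith [hk.2] : (k : ℝ) < ⌊b - a⌋ + 1)
  lia

theorem eventually_nhdsGT_disjoint_Ioo (J : Finset ℝ) (b : ℝ) :
    ∀ᶠ u in 𝓝[>] b, ∀ a ∈ J, ∀ k : ℤ, a + k ∉ Set.Ioo b u := by
  refine (Filter.eventually_all_finset J).2 fun a _ => ?_
  obtain ⟨u, hbu, hu⟩ := exists_gt_forall_add_intCast_notMem_Ioo a b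
  filter_upwards [Ioo_mem_nhdsGT hbu] with c hc k hk
  exact hu k (Set.Ioo_subset_Ioo_right hc.2.le hk)

theorem eventually_nhdsLT_disjoint_Ioo (J : Finset ℝ) (b : ℝ) :
    ∀ᶠ l in 𝓝[<] b, ∀ a ∈ J, ∀ k : ℤ, a + k ∉ Set.Ioo l b := by
  refine (Filter.eventually_all_finset J).2 fun a _ => ?_
  obtain ⟨u, hbu, hu⟩ := exists_gt_forall_add_intCast_notMem_Ioo (-a) (-b)
  filter_upwards [Ioo_mem_nhdsLT (neg_lt.1 hbu)] with c hc k hk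
  refine hu (-k) ⟨?_, ?_⟩ <;> push_cast <;> linarith [hk.1, hk.2, hc.1]

namespace IsDeligneFiltration

variable {F : Type*} [CommRing F] [Algebra ℂ F] {A : Subalgebra ℂ F}
  {E : Type*} [AddCommGroup E] [Module ℂ E] [Module F E]
  {t : F} {θ : Module.End ℂ E} {V V' : ℝ → Submodule ℂ E}

theorem apply_mem (h : IsDeligneFiltration A t θ V) {b : ℝ} {m : E} (hm : m ∈ V b) :
    θ m ∈ V b := by
  obtain ⟨S, hS⟩ := h.finite_type b
  rw [hS] at hm ⊢
  exact apply_mem_generated hm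

theorem smul_mem [SMulCommClass F ℂ E] (h : IsDeligneFiltration A t θ V) {b : ℝ} {a : F}
    (ha : a ∈ A) {m : E} (hm : m ∈ V b) : a • m ∈ V b := by
  obtain ⟨S, hS⟩ := h.finite_type b
  rw [hS] at hm ⊢
  exact smul_mem_generated ha hm

theorem apply_mem_above (h : IsDeligneFiltration A t θ V) {b : ℝ} {m : E} (hm : m ∈ above V b) :
    θ m ∈ above V b := by
  rw [mem_above h.antitone] at hm ⊢
  obtain ⟨c, hbc, hm⟩ := hm
  exact ⟨c, hbc, h.apply_mem hm⟩

theorem eventually_eq_above (h : IsDeligneFiltration A t θ V) (b : ℝ) :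
    ∀ᶠ c in 𝓝[>] b, V c = above V b := by
  obtain ⟨J, hJ⟩ := h.discrete
  filter_upwards [eventually_nhdsGT_disjoint_Ioo J b, self_mem_nhdsWithin] with c hc hbc
  refine le_antisymm (le_iSup_of_le (⟨c, hbc⟩ : Set.Ioi b) le_rfl) (iSup_le fun d => ?_)
  rcases le_total c d with hcd | hdc
  · exact h.antitone hcd
  · exact (hJ d c hdc fun a ha k hk => hc a ha k ⟨(Set.mem_Ioi.1 d.2).trans_le hk.1, hk.2⟩).le

theorem eventually_nhdsLT_eq (h : IsDeligneFiltration A t θ V) (b : ℝ) :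
    ∀ᶠ c in 𝓝[<] b, ∀ d ∈ Set.Ioc c b, V d = V b := by
  obtain ⟨J, hJ⟩ := h.discrete
  filter_upwards [eventually_nhdsLT_disjoint_Ioo J b] with c hc d hd
  exact hJ d b hd.2 fun a ha k hk => hc a ha k ⟨hd.1.trans_le hk.1, hk.2⟩

theorem induction_above (h : IsDeligneFiltration A t θ V) {p : Submodule ℂ E → Prop} {b c : ℝ}
    (hbc : b ≤ c) (base : p (V b)) (step : ∀ d ∈ Set.Ico b c, p (V d) → p (above V d)) :
    p (V c) := by
  let s : Set ℝ := {d ∈ Set.Icc b c | p (V d)}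
  have hs : IsLUB s (sSup s) := Real.isLUB_sSup ⟨b, ⟨le_rfl, hbc⟩, base⟩ ⟨c, fun d hd => hd.1.2⟩
  have hb : b ≤ sSup s := hs.1 ⟨⟨le_rfl, hbc⟩, base⟩
  have hc : sSup s ≤ c := hs.2 fun d hd => hd.1.2
  have hmax : p (V (sSup s)) := by
    obtain ⟨l, hl, hls⟩ := ((h.eventually_nhdsLT_eq (sSup s)).and self_mem_nhdsWithin).exists
    obtain ⟨d, hd, hld, hds⟩ := hs.exists_between hls
    exact hl d ⟨hld, hds⟩ ▸ hd.2
  rcases hc.eq_or_lt with heq | hlt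
  · exact heq ▸ hmax
  · obtain ⟨d, hd, hds, hdc⟩ :=
      ((h.eventually_eq_above (sSup s)).and (Ioc_mem_nhdsGT hlt)).exists
    exact absurd (hs.1 ⟨⟨hb.trans hds.le, hdc⟩, hd ▸ step _ ⟨hb, hlt⟩ hmax⟩) (not_le.2 hds)

theorem mem_of_apply_sub_smul_mem (h : IsDeligneFiltration A t θ V) {b : ℝ} {β : ℂ}
    (hβ : b ≤ β.re) {m : E} (hm : θ m - β • m ∈ V b) : m ∈ V b := by
  obtain ⟨c, hc⟩ := h.exhaustive m
  rcases le_total b c with hbc | hcb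
  · exact h.antitone hbc hc
  refine h.induction_above (p := (m ∈ ·)) hcb hc fun d hd hmd => ?_
  by_contra hmd'
  have hre := h.eigenvalue d m hmd hmd' β ((mem_above h.antitone).2 ⟨b, hd.2, hm⟩)
  linarith [hd.2]

theorem mem_of_aeval_mem (h : IsDeligneFiltration A t θ V) {b : ℝ} {Q : ℂ[X]} (hQ : RootsGE b Q)
    {m : E} (hm : aeval θ Q m ∈ V b) : m ∈ V b :=
  mem_of_aeval_apply_mem hQ.1 (fun β hβ _ => h.mem_of_apply_sub_smul_mem (hQ.2 β hβ)) hm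

theorem exists_aeval_mem (h : IsDeligneFiltration A t θ V) (b c : ℝ) :
    ∃ Q : ℂ[X], RootsGE b Q ∧ ∀ m ∈ V b, aeval θ Q m ∈ V c := by
  rcases le_total c b with hcb | hbc
  · exact ⟨1, .one b, fun m hm => by simpa using h.antitone hcb hm⟩
  refine h.induction_above (p := fun W => ∃ Q : ℂ[X], RootsGE b Q ∧ ∀ m ∈ V b, aeval θ Q m ∈ W)
    hbc ⟨1, .one b, fun m hm => by simpa using hm⟩ ?_
  rintro d ⟨hbd, -⟩ ⟨Q, hQ, hQV⟩
  have := h.finite_dim d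
  obtain ⟨R, hR, hRV, hRroots⟩ := exists_annihilating_quotient (θ := θ) (V := V d)
    (W := above V d) (fun _ => h.apply_mem) (fun _ => h.apply_mem_above)
  have hRb : RootsGE b R := ⟨hR, fun β hβ => by
    obtain ⟨m, hm, hm', hβm⟩ := hRroots β hβ
    exact hbd.trans (h.eigenvalue d m hm hm' β hβm).ge⟩
  exact ⟨R * Q, hRb.mul hQ, fun m hm => by rw [map_mul]; exact hRV _ (hQV m hm)⟩

theorem mem_add_natCast (h : IsDeligneFiltration A t θ V) (b : ℝ) (k : ℕ) {m : E} :
    m ∈ V (b + k) ↔ ∃ n ∈ V b, m = t ^ k • n := by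
  induction k generalizing m with
  | zero => simp
  | succ k ih =>
    rw [Nat.cast_succ, ← add_assoc, h.shift]
    constructor
    · rintro ⟨_, hk, rfl⟩
      obtain ⟨n, hn, rfl⟩ := ih.1 hk
      exact ⟨n, hn, by rw [pow_succ', mul_smul]⟩
    · rintro ⟨n, hn, rfl⟩
      exact ⟨t ^ k • n, ih.2 ⟨n, hn, rfl⟩, by rw [pow_succ', mul_smul]⟩

theorem exists_le [SMulCommClass F ℂ E] (h : IsDeligneFiltration A t θ V)
    (h' : IsDeligneFiltration A t θ V') (b : ℝ) : ∃ c, V b ≤ V' c := by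
  obtain ⟨S, hS⟩ := h.finite_type b
  choose f hf using h'.exhaustive
  obtain ⟨c, hc⟩ := (S.image f).bddBelow
  refine ⟨c, hS ▸ generated_le (fun m hm => ?_) (fun a ha m => h'.smul_mem ha)
    (fun m => h'.apply_mem)⟩
  exact h'.antitone (hc (Finset.mem_coe.2 (Finset.mem_image_of_mem f hm))) (hf m)

protected theorem le [SMulCommClass F ℂ E] (h : IsDeligneFiltration A t θ V)
    (h' : IsDeligneFiltration A t θ V') (b : ℝ) : V b ≤ V' b := by
  obtain ⟨c, hc⟩ := h.exists_le h' b
  obtain ⟨k, hk⟩ := exists_nat_ge (b - c)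
  obtain ⟨Q, hQ, hQV⟩ := h.exists_aeval_mem b (b + k)
  intro m hm
  obtain ⟨n, hn, hQm⟩ := (h.mem_add_natCast b k).1 (hQV m hm)
  exact h'.mem_of_aeval_mem hQ <|
    h'.antitone (by linarith : b ≤ c + k) ((h'.mem_add_natCast c k).2 ⟨n, hc hn, hQm⟩)

theorem deligne_eq [SMulCommClass F ℂ E] (h : IsDeligneFiltration A t θ V) :
    deligne A t θ = V := by
  funext b
  exact le_antisymm (iSup₂_le fun _ h' => h'.le h b) (le_iSup₂_of_le V h le_rfl)

end IsDeligneFiltration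

/-! ### Lattices and their rescalings -/

section FiniteQuotient

variable {E E' : Type*} [AddCommGroup E] [Module ℂ E] [AddCommGroup E'] [Module ℂ E']

theorem finite_quotient_of_comap {V W : Submodule ℂ E} {V' W' : Submodule ℂ E'} (f : E →ₗ[ℂ] E')
    (hV : V ≤ V'.comap f) (hW : V ⊓ W'.comap f ≤ W)
    [hfin : Module.Finite ℂ (V' ⧸ W'.submoduleOf V')] :
    Module.Finite ℂ (V ⧸ W.submoduleOf V) := by
  let g : V →ₗ[ℂ] V' ⧸ W'.submoduleOf V' := (W'.submoduleOf V').mkQ ∘ₗ f.restrict hV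
  have hg : LinearMap.ker g ≤ W.submoduleOf V := fun m hm =>
    hW ⟨m.2, (Submodule.Quotient.mk_eq_zero (W'.submoduleOf V')).1 (LinearMap.mem_ker.1 hm)⟩
  have := Module.Finite.equiv g.quotKerEquivRange.symm
  exact Module.Finite.of_surjective _ (Submodule.factor_surjective hg)

theorem finite_quotient_of_le_sup {N V W : Submodule ℂ E} [Module.Finite ℂ N] (hV : V ≤ N ⊔ W) :
    Module.Finite ℂ (V ⧸ W.submoduleOf V) := by
  have : Module.Finite ℂ (↥(N ⊔ W) ⧸ W.submoduleOf (N ⊔ W)) :=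
    Module.Finite.equiv (LinearMap.quotientInfEquivSupQuotient N W)
  exact finite_quotient_of_comap (V' := N ⊔ W) (W' := W) LinearMap.id hV inf_le_right

end FiniteQuotient

section Lattice

variable {F : Type*} [Field F] [Algebra ℂ F] {A : Subalgebra ℂ F}
  {E : Type*} [AddCommGroup E] [Module ℂ E] [Module F E]

/-- `t` is a uniformizer of the valuation ring `A` of `F`, and `A` has residue field `ℂ`. This is
what `ℂ{x} ⊆ ℂ{x}[1/x]` and `ℂ[[y]] ⊆ ℂ((y))` have in common. -/
structure IsUniformizer (A : Subalgebra ℂ F) (t : F) : Prop where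
  mem : t ∈ A
  ne_zero : t ≠ 0
  exists_eq_add_mul : ∀ a ∈ A, ∃ c : ℂ, ∃ a' ∈ A, a = algebraMap ℂ F c + t * a'
  exists_zpow_mul_mem : ∀ f : F, ∃ k : ℤ, t ^ k * f ∈ A

/-- `θ` satisfies the Leibniz rule of `t∂_t` with respect to the multiplication by `t`. -/
def IsEulerOperator (t : F) (θ : Module.End ℂ E) : Prop :=
  ∀ m, θ (t • m) = t • m + t • θ m

variable [IsScalarTower ℂ F E]

/-- The lattice `t ^ k L`. -/
def zpowLattice (t : F) (L : Submodule A E) (k : ℤ) : Submodule ℂ E :=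
  (L.restrictScalars ℂ).comap (DistribSMul.toLinearMap ℂ E (t ^ (-k)))

variable {t : F} {L : Submodule A E} {k l : ℤ} {m : E}

theorem mem_zpowLattice : m ∈ zpowLattice t L k ↔ t ^ (-k) • m ∈ L :=
  Iff.rfl

theorem smul_mem_zpowLattice {a : F} (ha : a ∈ A) (hm : m ∈ zpowLattice t L k) :
    a • m ∈ zpowLattice t L k := by
  rw [mem_zpowLattice, smul_comm]
  exact L.smul_mem ⟨a, ha⟩ hm

theorem zpow_smul_mem_zpowLattice (ht : t ≠ 0) :
    t ^ l • m ∈ zpowLattice t L k ↔ m ∈ zpowLattice t L (k - l) := by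
  rw [mem_zpowLattice, mem_zpowLattice, smul_smul, ← zpow_add₀ ht, neg_sub, neg_add_eq_sub]

theorem smul_mem_zpowLattice_add_one (ht : t ≠ 0) :
    t • m ∈ zpowLattice t L (k + 1) ↔ m ∈ zpowLattice t L k := by
  have h := zpow_smul_mem_zpowLattice (L := L) (k := k + 1) (l := 1) (m := m) ht
  rwa [zpow_one, add_sub_cancel_right] at h

theorem zpowLattice_antitone (ht : IsUniformizer A t) (L : Submodule A E) :
    Antitone (zpowLattice t L) := by
  intro k l hkl m hm
  obtain ⟨n, rfl⟩ := Int.le.dest hkl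
  rw [mem_zpowLattice] at hm ⊢
  have hn : t ^ n • t ^ (-(k + n)) • m ∈ L := L.smul_mem (⟨t ^ n, pow_mem ht.mem n⟩ : A) hm
  rwa [← zpow_natCast, smul_smul, ← zpow_add₀ ht.ne_zero, neg_add, add_comm (-k),
    add_neg_cancel_left] at hn

theorem exists_mem_zpowLattice (ht : IsUniformizer A t)
    (hL : Submodule.span F (L : Set E) = ⊤) (m : E) : ∃ k, m ∈ zpowLattice t L k := by
  induction (hL ▸ Submodule.mem_top : m ∈ Submodule.span F (L : Set E))
    using Submodule.span_induction with
  | mem m hm => exact ⟨0, by simpa [mem_zpowLattice] using hm⟩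
  | zero => exact ⟨0, zero_mem _⟩
  | add m n _ _ hm hn =>
    obtain ⟨k, hk⟩ := hm
    obtain ⟨l, hl⟩ := hn
    exact ⟨min k l, add_mem (zpowLattice_antitone ht L (min_le_left k l) hk)
      (zpowLattice_antitone ht L (min_le_right k l) hl)⟩
  | smul f m _ hm =>
    obtain ⟨k, hk⟩ := hm
    obtain ⟨l, hl⟩ := ht.exists_zpow_mul_mem f
    have hfm := smul_mem_zpowLattice hl hk
    rw [mul_smul, zpow_smul_mem_zpowLattice ht.ne_zero] at hfm
    exact ⟨k - l, hfm⟩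

theorem exists_map_mem_zpowLattice (ht : IsUniformizer A t)
    (hL : Submodule.span F (L : Set E) = ⊤) {E₀ : Type*} [AddCommGroup E₀] [Module F E₀]
    {L₀ : Submodule A E₀} (hL₀ : L₀.FG) (f : E₀ →ₗ[F] E) :
    ∃ k, ∀ m ∈ L₀, f m ∈ zpowLattice t L k := by
  obtain ⟨S, rfl⟩ := hL₀
  choose g hg using exists_mem_zpowLattice ht hL
  obtain ⟨k, hk⟩ := (S.image (g ∘ f)).bddBelow
  refine ⟨k, fun m hm => ?_⟩
  induction hm using Submodule.span_induction with
  | mem m hm =>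
    exact zpowLattice_antitone ht L
      (hk (Finset.mem_coe.2 (Finset.mem_image_of_mem _ hm))) (hg (f m))
  | zero => rw [map_zero]; exact zero_mem _
  | add m n _ _ hm hn => rw [map_add]; exact add_mem hm hn
  | smul a m _ hm =>
    have hsmul : f (a • m) = (a : F) • f m := f.map_smul (a : F) m
    exact hsmul ▸ smul_mem_zpowLattice a.2 hm

theorem exists_finset_coe_eq_span [IsNoetherianRing A] (ht : t ≠ 0) (hL : L.FG)
    {W : Submodule ℂ E} (hA : ∀ a ∈ A, ∀ m ∈ W, a • m ∈ W) (hW : W ≤ zpowLattice t L k) :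
    ∃ S : Finset E, (W : Set E) = Submodule.span A (S : Set E) := by
  let W' : Submodule A E := { W with smul_mem' := fun a m hm => hA a a.2 m hm }
  let f : E →ₗ[A] E := DistribSMul.toLinearMap A E (t ^ (-k))
  have hf : Function.Injective f := smul_right_injective E (zpow_ne_zero (-k) ht)
  have : IsNoetherian A L := isNoetherian_of_fg_of_noetherian L hL
  have hle : W'.map f ≤ L := Submodule.map_le_iff_le_comap.2 hW
  obtain ⟨S, hS⟩ := Submodule.fg_of_fg_map_injective f hf (isNoetherian_submodule.1 this _ hle)
  exact ⟨S, congrArg (fun N : Submodule A E => (N : Set E)) hS.symm⟩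

theorem finite_quotient_of_smul_mem (ht : IsUniformizer A t) {V W : Submodule ℂ E} {S : Finset E}
    (hV : (V : Set E) = Submodule.span A (S : Set E)) (hW : ∀ m ∈ V, t • m ∈ W) :
    Module.Finite ℂ (V ⧸ W.submoduleOf V) := by
  have := FiniteDimensional.span_finset ℂ S
  refine finite_quotient_of_le_sup (N := Submodule.span ℂ (S : Set E)) fun m hm => ?_
  have hVS : ∀ m, m ∈ V ↔ m ∈ Submodule.span A (S : Set E) := Set.ext_iff.1 hV
  have hmS := (hVS m).1 hm
  clear hm
  induction hmS using Submodule.span_induction with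
  | mem m hm => exact Submodule.mem_sup_left (Submodule.subset_span hm)
  | zero => exact zero_mem _
  | add m n _ _ hm hn => exact add_mem hm hn
  | smul a m hmS hm =>
    obtain ⟨c, a', ha', ha⟩ := ht.exists_eq_add_mul a a.2
    have hsmul : a • m = c • m + t • a' • m := by
      change (a : F) • m = _
      rw [ha, add_smul, algebraMap_smul, mul_smul]
    rw [hsmul]
    refine add_mem (Submodule.smul_mem _ c hm) (Submodule.mem_sup_right ?_)
    exact hW _ ((hVS _).2 (Submodule.smul_mem _ (⟨a', ha'⟩ : A) hmS))

end Lattice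

namespace IsEulerOperator

variable {F : Type*} [Field F] [Algebra ℂ F] {A : Subalgebra ℂ F}
  {E : Type*} [AddCommGroup E] [Module ℂ E] [Module F E] [IsScalarTower ℂ F E]
  {t : F} {θ : Module.End ℂ E} {L : Submodule A E}

theorem apply_pow_smul (hθ : IsEulerOperator t θ) (k : ℕ) (m : E) :
    θ (t ^ k • m) = t ^ k • (θ m + (k : ℂ) • m) := by
  induction k generalizing m with
  | zero => simp
  | succ k ih =>
    rw [pow_succ, mul_smul, ih, hθ, mul_smul, smul_comm (k : ℂ) t m, ← smul_add t, ← smul_add t,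
      Nat.cast_succ, add_smul, one_smul, add_assoc, add_comm m, add_assoc]

theorem apply_zpow_smul (ht : t ≠ 0) (hθ : IsEulerOperator t θ) (k : ℤ) (m : E) :
    θ (t ^ k • m) = t ^ k • (θ m + (k : ℂ) • m) := by
  obtain ⟨n, rfl | rfl⟩ := k.eq_nat_or_neg
  · simpa using hθ.apply_pow_smul n m
  · have htn := pow_ne_zero n ht
    have h := hθ.apply_pow_smul n (t ^ (-(n : ℤ)) • m)
    rw [zpow_neg, zpow_natCast, smul_inv_smul₀ htn] at h
    rw [h, zpow_neg, zpow_natCast, smul_add, inv_smul_smul₀ htn]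
    simp [smul_comm (t ^ n)⁻¹ (n : ℂ)]

theorem aeval_zpow_smul (ht : t ≠ 0) (hθ : IsEulerOperator t θ) (k : ℤ) (Q : ℂ[X]) (m : E) :
    aeval θ Q (t ^ k • m) =
      t ^ k • aeval θ (Q.comp (Polynomial.X + Polynomial.C (k : ℂ))) m := by
  rw [Polynomial.aeval_comp]
  refine (map_aeval_apply (DistribSMul.toLinearMap ℂ E (t ^ k)) (fun n => ?_) Q m).symm
  simp only [map_add, Polynomial.aeval_X, Polynomial.aeval_C, LinearMap.add_apply,
    Module.algebraMap_end_apply, DistribSMul.toLinearMap_apply, hθ.apply_zpow_smul ht,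
    smul_add]

theorem apply_mem_zpowLattice (ht : t ≠ 0) (hθ : IsEulerOperator t θ) (hL : ∀ m ∈ L, θ m ∈ L)
    {k : ℤ} {m : E} (hm : m ∈ zpowLattice t L k) : θ m ∈ zpowLattice t L k := by
  have h := hθ.apply_zpow_smul ht (-k) m
  rw [smul_add, smul_comm _ ((-k : ℤ) : ℂ) m] at h
  rw [mem_zpowLattice] at hm ⊢
  rw [← sub_eq_iff_eq_add.2 h]
  exact sub_mem (hL _ hm) ((L.restrictScalars ℂ).smul_mem _ hm)

end IsEulerOperator

/-! ### Existence of the Deligne filtration -/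

section SpectralPart

variable {E : Type*} [AddCommGroup E] [Module ℂ E] {θ : Module.End ℂ E} {W W' : Submodule ℂ E}
  {b c : ℝ} {β : ℂ} {m : E}

/-- The part of `E` on which, modulo `W`, the eigenvalues of `θ` have real part at least `b`. -/
def spectralPart (θ : Module.End ℂ E) (W : Submodule ℂ E) (b : ℝ) : Submodule ℂ E :=
  ⨆ Q : {Q : ℂ[X] // RootsGE b Q}, W.comap (aeval θ (Q : ℂ[X]))

theorem mem_spectralPart (hW : ∀ m ∈ W, θ m ∈ W) :
    m ∈ spectralPart θ W b ↔ ∃ Q : ℂ[X], RootsGE b Q ∧ aeval θ Q m ∈ W := by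
  have : Nonempty {Q : ℂ[X] // RootsGE b Q} := ⟨1, .one b⟩
  have hstable (P : ℂ[X]) {n : E} (hn : n ∈ W) : aeval θ P n ∈ W :=
    Polynomial.aeval_apply_smul_mem_of_le_comap hn P θ hW
  have hdir : Directed (· ≤ ·)
      fun Q : {Q : ℂ[X] // RootsGE b Q} => W.comap (aeval θ (Q : ℂ[X])) := by
    refine fun P Q => ⟨⟨P * Q, P.2.mul Q.2⟩, fun n hn => ?_, fun n hn => ?_⟩
    · change aeval θ (P.1 * Q.1) n ∈ W
      rw [mul_comm, map_mul]
      exact hstable Q hn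
    · change aeval θ (P.1 * Q.1) n ∈ W
      rw [map_mul]
      exact hstable P hn
  simp [spectralPart, Submodule.mem_iSup_of_directed _ hdir]

theorem spectralPart_antitone (θ : Module.End ℂ E) (W : Submodule ℂ E) :
    Antitone (spectralPart θ W) := fun _ _ hbc =>
  iSup_le fun Q => le_iSup_of_le (⟨Q, Q.2.mono hbc⟩ : {Q : ℂ[X] // RootsGE _ Q}) le_rfl

theorem apply_mem_spectralPart (hW : ∀ m ∈ W, θ m ∈ W) (hm : m ∈ spectralPart θ W b) :
    θ m ∈ spectralPart θ W b := by
  rw [mem_spectralPart hW] at hm ⊢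
  obtain ⟨Q, hQ, hQm⟩ := hm
  refine ⟨Q, hQ, ?_⟩
  rw [← map_aeval_apply θ fun _ => rfl]
  exact hW _ hQm

theorem mem_spectralPart_of_apply_sub_smul_mem (hW : ∀ m ∈ W, θ m ∈ W)
    (hm : θ m - β • m ∈ spectralPart θ W c) : m ∈ spectralPart θ W (min c β.re) := by
  rw [mem_spectralPart hW] at hm ⊢
  obtain ⟨Q, hQ, hQm⟩ := hm
  refine ⟨Q * (Polynomial.X - Polynomial.C β),
    (hQ.mono (min_le_left _ _)).mul ((RootsGE.X_sub_C β).mono (min_le_right _ _)), ?_⟩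
  simpa [sub_smul] using hQm

theorem mem_spectralPart_of_isRoot_imp (hW : ∀ m ∈ W, θ m ∈ W) (hm : m ∈ spectralPart θ W b)
    {R : ℂ[X]} (hRm : aeval θ R m ∈ W) (hR : ∀ β, R.IsRoot β → b ≤ β.re → c ≤ β.re) :
    m ∈ spectralPart θ W c := by
  rw [mem_spectralPart hW] at hm ⊢
  obtain ⟨Q, hQ, hQm⟩ := hm
  obtain ⟨G, hG, hGroots, hGm⟩ := exists_aeval_mem_of_isRoot_of_isRoot hW hQ.1 hQm hRm
  exact ⟨G, ⟨hG, fun β hβ => hR β (hGroots β hβ).2 (hQ.2 β (hGroots β hβ).1)⟩, hGm⟩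

theorem mem_spectralPart_of_re_lt (hW : ∀ m ∈ W, θ m ∈ W) (hm : m ∈ spectralPart θ W b)
    (hβ : β.re < b) (hβm : θ m - β • m ∈ spectralPart θ W c) : m ∈ spectralPart θ W c := by
  obtain ⟨R, hR, hRm⟩ := (mem_spectralPart hW).1 hβm
  refine mem_spectralPart_of_isRoot_imp hW hm (R := R * (Polynomial.X - Polynomial.C β))
    (by simpa [sub_smul] using hRm) fun γ hγ hbγ => ?_
  rcases Polynomial.root_mul.1 hγ with hγ | hγ
  · exact hR.2 γ hγ
  · rw [Polynomial.root_X_sub_C.1 hγ] at hβ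
    exact absurd hbγ (not_le.2 hβ)

end SpectralPart

section Existence

variable {F : Type*} [Field F] [Algebra ℂ F] {A : Subalgebra ℂ F}
  {E : Type*} [AddCommGroup E] [Module ℂ E] [Module F E] [IsScalarTower ℂ F E]
  {t : F} {θ : Module.End ℂ E} {L : Submodule A E} {b c : ℝ} {k : ℤ} {m : E}

/-- The Deligne filtration defined by a `θ`-stable lattice `L`: the elements which, modulo every
`t ^ k L`, only involve eigenvalues of `θ` of real part at least `b`. -/
def spectralFiltration (t : F) (θ : Module.End ℂ E) (L : Submodule A E) (b : ℝ) :
    Submodule ℂ E :=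
  ⨅ k : ℤ, spectralPart θ (zpowLattice t L k) b

theorem mem_spectralFiltration :
    m ∈ spectralFiltration t θ L b ↔ ∀ k : ℤ, m ∈ spectralPart θ (zpowLattice t L k) b :=
  Submodule.mem_iInf _

theorem spectralFiltration_antitone (t : F) (θ : Module.End ℂ E) (L : Submodule A E) :
    Antitone (spectralFiltration t θ L) :=
  fun _ _ hbc => iInf_mono fun _ => spectralPart_antitone _ _ hbc

/-- The finite set `J` contains the real parts of the eigenvalues of `θ` on `L / t L`, so that the
eigenvalues on `t ^ s L / t ^ k L` have real parts in `J + s, …, J + (k - 1)`. -/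
def IsExponentSet (t : F) (θ : Module.End ℂ E) (L : Submodule A E) (J : Finset ℝ) : Prop :=
  ∀ s k : ℤ, ∃ R : ℂ[X], R ≠ 0 ∧
    (∀ β, R.IsRoot β → ∃ a ∈ J, ∃ i ∈ Set.Ico s k, β.re = a + i) ∧
    ∀ m ∈ zpowLattice t L s, aeval θ R m ∈ zpowLattice t L k

variable (ht : IsUniformizer A t) (hθ : IsEulerOperator t θ) (hL : ∀ m ∈ L, θ m ∈ L)

include ht hθ in
theorem exists_aeval_mem_zpowLattice {Q : ℂ[X]} (hQ : Q ≠ 0)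
    (hQL : ∀ m ∈ zpowLattice t L 0, aeval θ Q m ∈ zpowLattice t L 1) (s k : ℤ) :
    ∃ R : ℂ[X], R ≠ 0 ∧
      (∀ β, R.IsRoot β → ∃ i ∈ Set.Ico s k, Q.IsRoot (β - (i : ℂ))) ∧
      ∀ m ∈ zpowLattice t L s, aeval θ R m ∈ zpowLattice t L k := by
  rcases le_total k s with hks | hsk
  · exact ⟨1, one_ne_zero, fun β hβ => by simp [Polynomial.IsRoot] at hβ,
      fun m hm => by simpa using zpowLattice_antitone ht L hks hm⟩
  induction k, hsk using Int.leInduction with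
  | base => exact ⟨1, one_ne_zero, fun β hβ => by simp [Polynomial.IsRoot] at hβ, by simp⟩
  | succ k hsk ih =>
    obtain ⟨R, hR, hRroots, hRL⟩ := ih
    let Qk : ℂ[X] := Q.comp (Polynomial.X + Polynomial.C ((-k : ℤ) : ℂ))
    refine ⟨Qk * R, mul_ne_zero (mt Polynomial.comp_X_add_C_eq_zero_iff.1 hQ) hR,
      fun β hβ => ?_, fun m hm => ?_⟩
    · rcases Polynomial.root_mul.1 hβ with hβ | hβ
      · refine ⟨k, ⟨hsk, lt_add_one k⟩, ?_⟩
        simpa [Qk, Polynomial.IsRoot, Polynomial.eval_comp, ← sub_eq_add_neg] using hβ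
      · obtain ⟨i, hi, hroot⟩ := hRroots β hβ
        exact ⟨i, ⟨hi.1, hi.2.trans (lt_add_one k)⟩, hroot⟩
    · have hRm : t ^ (-k) • aeval θ R m ∈ zpowLattice t L 0 := by
        rw [zpow_smul_mem_zpowLattice ht.ne_zero, zero_sub, neg_neg]
        exact hRL m hm
      have hQRm := hQL _ hRm
      rwa [hθ.aeval_zpow_smul ht.ne_zero, zpow_smul_mem_zpowLattice ht.ne_zero, sub_neg_eq_add,
        add_comm, ← Module.End.mul_apply, ← map_mul] at hQRm

include ht hθ hL in
theorem exists_isExponentSet (hfg : L.FG) : ∃ J, IsExponentSet t θ L J := by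
  obtain ⟨S, hS⟩ := hfg
  have : Module.Finite ℂ (zpowLattice t L 0 ⧸ (zpowLattice t L 1).submoduleOf _) := by
    refine finite_quotient_of_smul_mem ht (S := S) ?_ fun m hm => ?_
    · rw [hS]
      ext m
      simp [mem_zpowLattice]
    · exact (smul_mem_zpowLattice_add_one (k := 0) ht.ne_zero).2 hm
  have hstable (k : ℤ) (m : E) : m ∈ zpowLattice t L k → θ m ∈ zpowLattice t L k :=
    hθ.apply_mem_zpowLattice ht.ne_zero hL
  obtain ⟨Q, hQ, hQL, -⟩ := exists_annihilating_quotient (hstable 0) (hstable 1)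
  refine ⟨Q.roots.toFinset.image Complex.re, fun s k => ?_⟩
  obtain ⟨R, hR, hRroots, hRL⟩ := exists_aeval_mem_zpowLattice ht hθ hQ hQL s k
  refine ⟨R, hR, fun β hβ => ?_, hRL⟩
  obtain ⟨i, hi, hroot⟩ := hRroots β hβ
  have hmem : β - i ∈ Q.roots.toFinset :=
    Multiset.mem_toFinset.2 ((Polynomial.mem_roots hQ).2 hroot)
  exact ⟨_, Finset.mem_image_of_mem _ hmem, i, hi, by simp⟩

include ht hθ hL

theorem mem_spectralPart_zpowLattice : m ∈ spectralPart θ (zpowLattice t L k) b ↔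
    ∃ Q : ℂ[X], RootsGE b Q ∧ aeval θ Q m ∈ zpowLattice t L k :=
  mem_spectralPart fun _ => hθ.apply_mem_zpowLattice ht.ne_zero hL

theorem apply_mem_spectralFiltration (hm : m ∈ spectralFiltration t θ L b) :
    θ m ∈ spectralFiltration t θ L b :=
  mem_spectralFiltration.2 fun k => apply_mem_spectralPart
    (fun _ => hθ.apply_mem_zpowLattice ht.ne_zero hL) (mem_spectralFiltration.1 hm k)

theorem zpow_smul_mem_spectralFiltration (l : ℤ) (hm : m ∈ spectralFiltration t θ L b) :
    t ^ l • m ∈ spectralFiltration t θ L (b + l) := by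
  simp only [mem_spectralFiltration, mem_spectralPart_zpowLattice ht hθ hL] at hm ⊢
  intro k
  obtain ⟨Q, hQ, hQm⟩ := hm (k - l)
  refine ⟨Q.comp (Polynomial.X + Polynomial.C (((-l : ℤ)) : ℂ)),
    by simpa using hQ.comp_X_add_C ((-l : ℤ) : ℂ), ?_⟩
  rw [hθ.aeval_zpow_smul ht.ne_zero, zpow_smul_mem_zpowLattice ht.ne_zero, Polynomial.comp_assoc]
  simpa using hQm

theorem mem_spectralFiltration_add_one :
    m ∈ spectralFiltration t θ L (b + 1) ↔ ∃ n ∈ spectralFiltration t θ L b, m = t • n := by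
  constructor
  · intro hm
    have hn := zpow_smul_mem_spectralFiltration ht hθ hL (-1) hm
    exact ⟨t⁻¹ • m, by simpa using hn, (smul_inv_smul₀ ht.ne_zero m).symm⟩
  · rintro ⟨n, hn, rfl⟩
    simpa using zpow_smul_mem_spectralFiltration ht hθ hL 1 hn

theorem smul_mem_spectralFiltration (hspan : Submodule.span F (L : Set E) = ⊤) {a : F}
    (ha : a ∈ A) (hm : m ∈ spectralFiltration t θ L b) : a • m ∈ spectralFiltration t θ L b := by
  refine mem_spectralFiltration.2 fun k => ?_
  obtain ⟨s, hs⟩ := exists_mem_zpowLattice ht hspan m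
  obtain ⟨n, hn⟩ : ∃ n : ℕ, k ≤ s + n := ⟨(k - s).toNat, by have := Int.self_le_toNat (k - s); lia⟩
  induction n generalizing s a m with
  | zero =>
    have ham := zpowLattice_antitone ht L (by simpa using hn) (smul_mem_zpowLattice ha hs)
    exact (mem_spectralPart_zpowLattice ht hθ hL).2 ⟨1, .one b, by simpa using ham⟩
  | succ n ih =>
    obtain ⟨c, a', ha', rfl⟩ := ht.exists_eq_add_mul a ha
    rw [add_smul, algebraMap_smul, mul_comm, mul_smul]
    refine add_mem (Submodule.smul_mem _ c (mem_spectralFiltration.1 hm k)) ?_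
    refine ih ha' ?_ (s + 1) ?_ (by push_cast at hn; lia)
    · exact spectralFiltration_antitone t θ L (by linarith : b ≤ b + 1)
        ((mem_spectralFiltration_add_one ht hθ hL).2 ⟨m, hm, rfl⟩)
    · exact (smul_mem_zpowLattice_add_one ht.ne_zero).2 hs

theorem spectralFiltration_le_zpowLattice (hspan : Submodule.span F (L : Set E) = ⊤)
    {J : Finset ℝ} (hJ : IsExponentSet t θ L J) (hk : ∀ a ∈ J, a + k ≤ b) :
    spectralFiltration t θ L b ≤ zpowLattice t L k := by
  intro m hm
  obtain ⟨s, hs⟩ := exists_mem_zpowLattice ht hspan m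
  obtain ⟨R, -, hRroots, hRL⟩ := hJ s k
  obtain ⟨Q, hQ, hQm⟩ :=
    (mem_spectralPart_zpowLattice ht hθ hL).1 (mem_spectralFiltration.1 hm k)
  obtain ⟨G, hG, hGroots, hGm⟩ := exists_aeval_mem_of_isRoot_of_isRoot
    (fun _ => hθ.apply_mem_zpowLattice ht.ne_zero hL) hQ.1 hQm (hRL m hs)
  refine mem_of_aeval_apply_mem hG (fun β hβ => ?_) hGm
  obtain ⟨a, ha, i, hi, hβi⟩ := hRroots β (hGroots β hβ).2
  have hbβ := hQ.2 β (hGroots β hβ).1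
  have hik : (i : ℝ) < k := Int.cast_lt.2 hi.2
  linarith [hk a ha]

theorem zpowLattice_le_spectralFiltration {J : Finset ℝ} (hJ : IsExponentSet t θ L J)
    (hk : ∀ a ∈ J, b ≤ a + k) : zpowLattice t L k ≤ spectralFiltration t θ L b := by
  refine fun m hm => mem_spectralFiltration.2 fun l => ?_
  obtain ⟨R, hR, hRroots, hRL⟩ := hJ k l
  refine (mem_spectralPart_zpowLattice ht hθ hL).2 ⟨R, ⟨hR, fun β hβ => ?_⟩, hRL m hm⟩
  obtain ⟨a, ha, i, hi, hβi⟩ := hRroots β hβ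
  have hki : (k : ℝ) ≤ i := Int.cast_le.2 hi.1
  linarith [hk a ha]

theorem spectralFiltration_eq_of_notMem_Ico (hspan : Submodule.span F (L : Set E) = ⊤)
    {J : Finset ℝ} (hJ : IsExponentSet t θ L J) (hbc : b ≤ c)
    (h : ∀ a ∈ J, ∀ k : ℤ, a + k ∉ Set.Ico b c) :
    spectralFiltration t θ L b = spectralFiltration t θ L c := by
  refine le_antisymm (fun m hm => mem_spectralFiltration.2 fun k => ?_)
    (spectralFiltration_antitone t θ L hbc)
  obtain ⟨s, hs⟩ := exists_mem_zpowLattice ht hspan m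
  obtain ⟨R, -, hRroots, hRL⟩ := hJ s k
  refine mem_spectralPart_of_isRoot_imp (fun _ => hθ.apply_mem_zpowLattice ht.ne_zero hL)
    (mem_spectralFiltration.1 hm k) (hRL m hs) fun β hβ hbβ => ?_
  obtain ⟨a, ha, i, -, hβi⟩ := hRroots β hβ
  by_contra hβc
  exact h a ha i (hβi ▸ ⟨hbβ, not_le.1 hβc⟩)

theorem re_eq_of_apply_sub_smul_mem_above (hm : m ∈ spectralFiltration t θ L b)
    (hm' : m ∉ above (spectralFiltration t θ L) b) {β : ℂ}
    (hβ : θ m - β • m ∈ above (spectralFiltration t θ L) b) : β.re = b := by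
  have hanti := spectralFiltration_antitone t θ L
  have hstable (k : ℤ) (m : E) : m ∈ zpowLattice t L k → θ m ∈ zpowLattice t L k :=
    hθ.apply_mem_zpowLattice ht.ne_zero hL
  rw [mem_above hanti] at hm' hβ
  obtain ⟨c, hbc, hc⟩ := hβ
  rw [mem_spectralFiltration] at hm hc
  by_contra hne
  rcases lt_or_gt_of_ne hne with hlt | hgt
  · exact hm' ⟨c, hbc, mem_spectralFiltration.2 fun k =>
      mem_spectralPart_of_re_lt (hstable k) (hm k) hlt (hc k)⟩
  · exact hm' ⟨min c β.re, lt_min hbc hgt, mem_spectralFiltration.2 fun k =>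
      mem_spectralPart_of_apply_sub_smul_mem (hstable k) (hc k)⟩

theorem exists_isDeligneFiltration [IsNoetherianRing A] (hfg : L.FG)
    (hspan : Submodule.span F (L : Set E) = ⊤) :
    ∃ V : ℝ → Submodule ℂ E, IsDeligneFiltration A t θ V ∧
      ∀ b, ∃ k : ℤ, V b ≤ zpowLattice t L k := by
  obtain ⟨J, hJ⟩ := exists_isExponentSet ht hθ hL hfg
  let V := spectralFiltration t θ L
  have hanti : Antitone V := spectralFiltration_antitone t θ L
  have hbound (b : ℝ) : ∃ k : ℤ, V b ≤ zpowLattice t L k := by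
    obtain ⟨r, hr⟩ := J.bddAbove
    refine ⟨⌊b - r⌋, spectralFiltration_le_zpowLattice ht hθ hL hspan hJ fun a ha => ?_⟩
    linarith [hr ha, Int.floor_le (b - r)]
  have hA (b : ℝ) (a : F) (ha : a ∈ A) (m : E) (hm : m ∈ V b) : a • m ∈ V b :=
    smul_mem_spectralFiltration ht hθ hL hspan ha hm
  have hspanA (b : ℝ) : ∃ S : Finset E, (V b : Set E) = Submodule.span A (S : Set E) := by
    obtain ⟨k, hk⟩ := hbound b
    exact exists_finset_coe_eq_span ht.ne_zero hfg (hA b) hk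
  have hshift (b : ℝ) (m : E) : m ∈ V (b + 1) ↔ ∃ n ∈ V b, m = t • n :=
    mem_spectralFiltration_add_one ht hθ hL
  refine ⟨V, ⟨hanti, fun m => ?_, fun b => ?_, hshift, ⟨J, fun b c =>
    spectralFiltration_eq_of_notMem_Ico ht hθ hL hspan hJ⟩, fun b => ?_,
    fun b m hm hm' β => re_eq_of_apply_sub_smul_mem_above ht hθ hL hm hm'⟩, hbound⟩
  · obtain ⟨s, hs⟩ := exists_mem_zpowLattice ht hspan m
    obtain ⟨r, hr⟩ := J.bddBelow
    exact ⟨r + s, zpowLattice_le_spectralFiltration ht hθ hL hJ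
      (fun a ha => add_le_add_left (hr ha) _) hs⟩
  · obtain ⟨S, hS⟩ := hspanA b
    refine ⟨S, le_antisymm (fun m hm => ?_) (generated_le ?_ (hA b)
      fun m => apply_mem_spectralFiltration ht hθ hL)⟩
    · exact span_subset_generated θ _ (hS ▸ hm)
    · exact hS ▸ Submodule.subset_span
  · obtain ⟨S, hS⟩ := hspanA b
    refine finite_quotient_of_smul_mem ht hS fun m hm => (mem_above hanti).2 ?_
    exact ⟨b + 1, lt_add_one b, (hshift b _).2 ⟨m, hm, rfl⟩⟩

end Existence

/-! ### Pull-backs of Deligne filtrations -/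

section Rescale

variable {E E' : Type*} [AddCommGroup E] [Module ℂ E] [AddCommGroup E'] [Module ℂ E']
  {V' : ℝ → Submodule ℂ E'} {q : ℕ+}

theorem above_comap_mul (hV' : Antitone V') (ρ : E →ₗ[ℂ] E') (b : ℝ) :
    above (fun b => (V' (q * b)).comap ρ) b = (above V' (q * b)).comap ρ := by
  have hq : (0 : ℝ) < (q : ℕ) := Nat.cast_pos.2 q.pos
  have hV : Antitone fun b => (V' (q * b)).comap ρ := fun _ _ h =>
    Submodule.comap_mono (hV' (mul_le_mul_of_nonneg_left h hq.le))
  ext m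
  rw [mem_above hV, Submodule.mem_comap, mem_above hV']
  constructor
  · rintro ⟨c, hbc, hm⟩
    exact ⟨q * c, mul_lt_mul_of_pos_left hbc hq, hm⟩
  · rintro ⟨c, hbc, hm⟩
    refine ⟨c / (q : ℕ), (lt_div_iff₀' hq).2 hbc, ?_⟩
    rwa [Submodule.mem_comap, mul_div_cancel₀ _ hq.ne']

end Rescale

namespace IsDeligneFiltration

section Rescale

variable {F : Type*} [CommRing F] [Algebra ℂ F] {A : Subalgebra ℂ F}
  {E : Type*} [AddCommGroup E] [Module ℂ E] [Module F E]
  {t : F} {θ : Module.End ℂ E} {V : ℝ → Submodule ℂ E}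

theorem discrete_mul (h : IsDeligneFiltration A t θ V) (q : ℕ+) :
    ∃ J : Finset ℝ, ∀ b c, b ≤ c → (∀ a ∈ J, ∀ k : ℤ, a + k ∉ Set.Ico b c) →
      V (q * b) = V (q * c) := by
  have hq : (0 : ℝ) < (q : ℕ) := Nat.cast_pos.2 q.pos
  obtain ⟨J, hJ⟩ := h.discrete
  refine ⟨(J ×ˢ Finset.Ico 0 (q : ℤ)).image fun p => (p.1 + p.2) / (q : ℕ), fun b c hbc hbcJ =>
    hJ _ _ (mul_le_mul_of_nonneg_left hbc hq.le) fun a ha k hk => ?_⟩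
  have hmod : k % (q : ℕ) ∈ Finset.Ico 0 ((q : ℕ) : ℤ) := Finset.mem_Ico.2
    ⟨Int.emod_nonneg k (Int.natCast_ne_zero.2 q.ne_zero),
      Int.emod_lt_of_pos k (Int.natCast_pos.2 q.pos)⟩
  have hdiv : (a + (k % (q : ℕ) : ℤ)) / (q : ℕ) + (k / (q : ℕ) : ℤ) = (a + k) / (q : ℕ) := by
    rw [div_add' _ _ _ hq.ne', add_assoc, mul_comm]
    congr 2
    exact_mod_cast Int.emod_add_mul_ediv k (q : ℕ)
  refine hbcJ _ (Finset.mem_image_of_mem _ (Finset.mk_mem_product ha hmod)) (k / (q : ℕ)) ?_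
  rw [hdiv]
  exact ⟨(le_div_iff₀' hq).2 hk.1, (div_lt_iff₀' hq).2 hk.2⟩

end Rescale

variable {F : Type*} [Field F] [Algebra ℂ F] {A : Subalgebra ℂ F}
  {E : Type*} [AddCommGroup E] [Module ℂ E] [Module F E]
  {t : F} {θ : Module.End ℂ E} {V : ℝ → Submodule ℂ E}

theorem zpow_smul_mem (h : IsDeligneFiltration A t θ V) (ht : t ≠ 0) {b : ℝ} (k : ℤ) {m : E} :
    t ^ k • m ∈ V (b + k) ↔ m ∈ V b := by
  have pow_smul_mem (b : ℝ) (k : ℕ) (m : E) : t ^ k • m ∈ V (b + k) ↔ m ∈ V b := by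
    rw [h.mem_add_natCast]
    constructor
    · rintro ⟨n, hn, hmn⟩
      rwa [smul_right_injective E (pow_ne_zero k ht) hmn]
    · exact fun hm => ⟨m, hm, rfl⟩
  obtain ⟨n, rfl | rfl⟩ := k.eq_nat_or_neg
  · simpa using pow_smul_mem b n m
  · rw [← pow_smul_mem _ n, smul_smul, ← zpow_natCast, ← zpow_add₀ ht]
    simp

theorem top (ht : t ≠ 0) (hfin : ∃ S : Finset E, ⊤ = generated A θ (S : Set E)) :
    IsDeligneFiltration A t θ fun _ => ⊤ where
  antitone := antitone_const
  exhaustive _ := ⟨0, trivial⟩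
  finite_type _ := hfin
  shift _ m := iff_of_true trivial ⟨t⁻¹ • m, trivial, (smul_inv_smul₀ ht m).symm⟩
  discrete := ⟨∅, fun _ _ _ _ => rfl⟩
  finite_dim b := by
    rw [above_const, Submodule.submoduleOf_self]
    infer_instance
  eigenvalue b m hm hm' := absurd (by rwa [above_const]) hm'

theorem comap_mul {F' : Type*} [Field F'] [Algebra ℂ F'] {A' : Subalgebra ℂ F'} {E' : Type*}
    [AddCommGroup E'] [Module ℂ E'] [Module F' E'] {t' : F'} {θ' : Module.End ℂ E'}
    {V' : ℝ → Submodule ℂ E'} (hV' : IsDeligneFiltration A' t' θ' V') (ht' : t' ≠ 0) (ht : t ≠ 0)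
    {q : ℕ+} {ρ : E →ₗ[ℂ] E'} (hρt : ∀ m, ρ (t • m) = t' ^ (q : ℕ) • ρ m)
    (hρθ : ∀ m, θ' (ρ m) = ((q : ℕ) : ℂ) • ρ (θ m))
    (hfin : ∀ b : ℝ, ∃ S : Finset E, (V' (q * b)).comap ρ = generated A θ (S : Set E)) :
    IsDeligneFiltration A t θ fun b => (V' (q * b)).comap ρ where
  antitone _ _ hbc := Submodule.comap_mono (hV'.antitone (by gcongr))
  exhaustive m := by
    obtain ⟨b, hb⟩ := hV'.exhaustive (ρ m)
    refine ⟨b / (q : ℕ), ?_⟩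
    rwa [Submodule.mem_comap, mul_div_cancel₀ _ (Nat.cast_ne_zero.2 q.ne_zero)]
  finite_type := hfin
  shift b m := by
    have smul_mem_iff (n : E) : ρ (t • n) ∈ V' (q * (b + 1)) ↔ ρ n ∈ V' (q * b) := by
      rw [hρt, mul_add, mul_one]
      simpa using hV'.zpow_smul_mem ht' (b := q * b) (q : ℕ) (m := ρ n)
    constructor
    · intro hm
      refine ⟨t⁻¹ • m, (smul_mem_iff _).1 ?_, (smul_inv_smul₀ ht m).symm⟩
      rwa [smul_inv_smul₀ ht]
    · rintro ⟨n, hn, rfl⟩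
      exact (smul_mem_iff n).2 hn
  discrete := by
    obtain ⟨J, hJ⟩ := hV'.discrete_mul q
    exact ⟨J, fun b c hbc h => congrArg (Submodule.comap ρ) (hJ b c hbc h)⟩
  finite_dim b := by
    have := hV'.finite_dim (q * b)
    rw [above_comap_mul hV'.antitone]
    exact finite_quotient_of_comap ρ le_rfl inf_le_right
  eigenvalue b m hm hm' β hβ := by
    have hq : ((q : ℕ) : ℂ) ≠ 0 := Nat.cast_ne_zero.2 q.ne_zero
    rw [above_comap_mul hV'.antitone] at hm' hβ
    have hre : (((q : ℕ) : ℂ) * β).re = q * b := by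
      refine hV'.eigenvalue (q * b) (ρ m) hm hm' _ ?_
      rw [hρθ, mul_smul, ← smul_sub, ← map_smul ρ, ← map_sub]
      exact Submodule.smul_mem _ _ hβ
    rw [← Complex.ofReal_natCast, Complex.re_ofReal_mul] at hre
    exact mul_left_cancel₀ (Nat.cast_ne_zero.2 q.ne_zero) hre

end IsDeligneFiltration

/-! ### Convergent power series -/

theorem exists_sum_range_mul_pow_succ_le {a : ℕ → ℝ} (ha : ∀ n, 0 ≤ a n) {r c : ℝ} (hr : 0 < r)
    (hc : 0 < c) (hs : Summable fun n => a n * r ^ n) :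
    ∃ ρ : ℝ, 0 < ρ ∧ ∀ n, ∑ k ∈ Finset.range n, a (k + 1) * ρ ^ (k + 1) ≤ c := by
  set B := ∑' n, a n * r ^ n
  have hB : 0 ≤ B := tsum_nonneg fun n => mul_nonneg (ha n) (by positivity)
  set s := min 1 (c / (B + 1))
  have hs0 : 0 < s := lt_min one_pos (by positivity)
  have hsB : s * B ≤ c :=
    calc s * B ≤ c / (B + 1) * (B + 1) := by
          gcongr
          exacts [min_le_right _ _, le_add_of_nonneg_right zero_le_one]
      _ = c := by field_simp
  have hterm (k : ℕ) : 0 ≤ a k * r ^ k := mul_nonneg (ha k) (by positivity)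
  refine ⟨r * s, by positivity, fun n => ?_⟩
  calc ∑ k ∈ Finset.range n, a (k + 1) * (r * s) ^ (k + 1)
      = ∑ k ∈ Finset.range n, s ^ (k + 1) * (a (k + 1) * r ^ (k + 1)) :=
        Finset.sum_congr rfl fun k _ => by ring
    _ ≤ ∑ k ∈ Finset.range n, s * (a (k + 1) * r ^ (k + 1)) :=
        Finset.sum_le_sum fun k _ => mul_le_mul_of_nonneg_right
          (pow_le_of_le_one hs0.le (min_le_left _ _) k.succ_ne_zero) (hterm _)
    _ = s * ∑ k ∈ Finset.range n, a (k + 1) * r ^ (k + 1) := (Finset.mul_sum ..).symm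
    _ ≤ s * B := by
        gcongr
        calc ∑ k ∈ Finset.range n, a (k + 1) * r ^ (k + 1)
            ≤ ∑ k ∈ Finset.range (n + 1), a k * r ^ k := by
              rw [Finset.sum_range_succ']
              exact le_add_of_nonneg_right (hterm 0)
          _ ≤ B := hs.sum_le_tsum _ fun n _ => hterm n
    _ ≤ c := hsB

theorem constantCoeff_mul_coeff_succ_inv {K : Type*} [Field K] {f : K⟦X⟧}
    (h0 : PowerSeries.constantCoeff f ≠ 0) (n : ℕ) :
    PowerSeries.constantCoeff f * PowerSeries.coeff (n + 1) f⁻¹ =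
      -∑ p ∈ antidiagonal n, PowerSeries.coeff (p.1 + 1) f * PowerSeries.coeff p.2 f⁻¹ := by
  have h : PowerSeries.coeff (n + 1) (f * f⁻¹) = 0 := by
    rw [PowerSeries.mul_inv_cancel _ h0, PowerSeries.coeff_one, if_neg n.succ_ne_zero]
  rw [PowerSeries.coeff_mul, Finset.Nat.antidiagonal_succ, Finset.sum_cons, Finset.sum_map] at h
  rw [eq_neg_iff_add_eq_zero]
  simpa using h

theorem norm_coeff_inv_mul_pow_le {K : Type*} [NormedField K] {f : K⟦X⟧}
    (h0 : PowerSeries.constantCoeff f ≠ 0) {ρ : ℝ} (hρ : 0 < ρ)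
    (hf : ∀ n, ∑ k ∈ Finset.range n, ‖PowerSeries.coeff (k + 1) f‖ * ρ ^ (k + 1) ≤
      ‖PowerSeries.constantCoeff f‖) (n : ℕ) :
    ‖PowerSeries.coeff n f⁻¹‖ * ρ ^ n ≤ ‖PowerSeries.constantCoeff f‖⁻¹ := by
  set c := ‖PowerSeries.constantCoeff f‖ with hc
  have hc0 : 0 < c := norm_pos_iff.2 h0
  induction n using Nat.strong_induction_on with
  | _ n ih =>
    rcases n with - | n
    · simp [hc]
    refine le_of_mul_le_mul_left ?_ hc0
    rw [← mul_assoc, hc, ← norm_mul, constantCoeff_mul_coeff_succ_inv h0, norm_neg, ← hc]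
    calc ‖∑ p ∈ antidiagonal n, PowerSeries.coeff (p.1 + 1) f *
          PowerSeries.coeff p.2 f⁻¹‖ * ρ ^ (n + 1)
        ≤ (∑ p ∈ antidiagonal n, ‖PowerSeries.coeff (p.1 + 1) f *
          PowerSeries.coeff p.2 f⁻¹‖) * ρ ^ (n + 1) := by
          gcongr
          exact norm_sum_le _ _
      _ = ∑ p ∈ antidiagonal n, (‖PowerSeries.coeff (p.1 + 1) f‖ * ρ ^ (p.1 + 1)) *
          (‖PowerSeries.coeff p.2 f⁻¹‖ * ρ ^ p.2) := by
          rw [Finset.sum_mul]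
          refine Finset.sum_congr rfl fun p hp => ?_
          rw [← mem_antidiagonal.1 hp, norm_mul]
          ring
      _ ≤ ∑ p ∈ antidiagonal n, (‖PowerSeries.coeff (p.1 + 1) f‖ * ρ ^ (p.1 + 1)) *
          c⁻¹ := by
          refine Finset.sum_le_sum fun p hp => ?_
          gcongr
          exact ih p.2 (Nat.lt_succ_of_le (antidiagonal.snd_le hp))
      _ = (∑ k ∈ Finset.range (n + 1), ‖PowerSeries.coeff (k + 1) f‖ * ρ ^ (k + 1)) * c⁻¹ := by
          rw [← Finset.sum_mul, Finset.Nat.sum_antidiagonal_eq_sum_range_succ_mk]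
      _ ≤ c * c⁻¹ := by
          gcongr
          exact hf _

theorem mem_convPS_of_norm_coeff_mul_pow_le {f : ℂ⟦X⟧} {ρ C : ℝ} (hρ : 0 < ρ)
    (hf : ∀ n, ‖PowerSeries.coeff n f‖ * ρ ^ n ≤ C) : f ∈ convPS := by
  refine ⟨ρ / 2, half_pos hρ, .of_nonneg_of_le (fun n => by positivity) (fun n => ?_)
    (summable_geometric_two.mul_left C)⟩
  calc ‖PowerSeries.coeff n f‖ * (ρ / 2) ^ n
      = ‖PowerSeries.coeff n f‖ * ρ ^ n * (1 / 2) ^ n := by ring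
    _ ≤ C * (1 / 2) ^ n := by
        gcongr
        exact hf n

theorem inv_mem_convPS {f : ℂ⟦X⟧} (hf : f ∈ convPS) (h0 : PowerSeries.constantCoeff f ≠ 0) :
    f⁻¹ ∈ convPS := by
  obtain ⟨r, hr, hs⟩ := hf
  obtain ⟨ρ, hρ, h⟩ := exists_sum_range_mul_pow_succ_le (fun n => norm_nonneg _) hr
    (norm_pos_iff.2 h0) hs
  exact mem_convPS_of_norm_coeff_mul_pow_le hρ (norm_coeff_inv_mul_pow_le h0 hρ h)

theorem mem_convPS_of_X_pow_mul_mem {g : ℂ⟦X⟧} {n : ℕ}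
    (h : (PowerSeries.X : ℂ⟦X⟧) ^ n * g ∈ convPS) : g ∈ convPS := by
  obtain ⟨r, hr, hs⟩ := h
  refine ⟨r, hr, (((summable_nat_add_iff n).2 hs).mul_right (r ^ n)⁻¹).congr fun m => ?_⟩
  rw [PowerSeries.coeff_X_pow_mul, pow_add]
  field_simp

theorem exists_convPS_eq_X_pow_mul {g : ℂ⟦X⟧} (hg : g ∈ convPS) (h0 : g ≠ 0) :
    ∃ n : ℕ, ∃ u ∈ convPS, PowerSeries.constantCoeff u ≠ 0 ∧ g = PowerSeries.X ^ n * u := by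
  have hu : PowerSeries.X ^ g.order.toNat * g.divXPowOrder = g :=
    PowerSeries.X_pow_order_mul_divXPowOrder
  exact ⟨g.order.toNat, g.divXPowOrder, mem_convPS_of_X_pow_mul_mem (hu ▸ hg),
    mt PowerSeries.constantCoeff_divXPowOrder_eq_zero_iff.1 h0, hu.symm⟩

theorem isUnit_convPS {u : convPS} (h : PowerSeries.constantCoeff (u : ℂ⟦X⟧) ≠ 0) : IsUnit u :=
  IsUnit.of_mul_eq_one ⟨_, inv_mem_convPS u.2 h⟩ (Subtype.ext (PowerSeries.mul_inv_cancel _ h))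

theorem irreducible_X_convPS : Irreducible (⟨PowerSeries.X, X_mem_convPS⟩ : convPS) := by
  have hX : Irreducible (PowerSeries.X : ℂ⟦X⟧) := PowerSeries.X_prime.irreducible
  have isUnit_of_coe (u : convPS) (hu : IsUnit (u : ℂ⟦X⟧)) : IsUnit u :=
    isUnit_convPS (PowerSeries.isUnit_iff_constantCoeff.1 hu).ne_zero
  exact ⟨fun h => hX.1 (h.map convPS.val), fun a b hab =>
    (hX.2 (congrArg Subtype.val hab)).imp (isUnit_of_coe a) (isUnit_of_coe b)⟩

instance : IsDiscreteValuationRing convPS := by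
  refine IsDiscreteValuationRing.ofHasUnitMulPowIrreducibleFactorization
    ⟨_, irreducible_X_convPS, fun {g} hg => ?_⟩
  obtain ⟨n, u, hu, hu0, e⟩ := exists_convPS_eq_X_pow_mul g.2 fun h => hg (Subtype.ext h)
  obtain ⟨v, hv⟩ := isUnit_convPS (u := ⟨u, hu⟩) hu0
  exact ⟨n, v, Subtype.ext (by rw [hv]; exact e.symm)⟩

/-! ### Coefficients of Laurent series -/

theorem ofPS_injective : Function.Injective ofPS := HahnSeries.ofPowerSeries_injective

theorem mem_range_ofPS {f : Laurent} : f ∈ ofPS.range ↔ ∀ n < 0, f.coeff n = 0 := by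
  constructor
  · rintro ⟨g, rfl⟩ n hn
    exact coeff_ofPS_of_neg g hn
  · intro h
    refine ⟨PowerSeries.mk fun n => f.coeff n, Laurent.ext fun n => ?_⟩
    change (ofPS _).coeff n = _
    rcases lt_or_ge n 0 with hn | hn
    · rw [coeff_ofPS_of_neg _ hn, h n hn]
    · lift n to ℕ using hn
      rw [coeff_ofPS_natCast, PowerSeries.coeff_mk]

namespace Laurent

theorem x_pow (k : ℕ) : x ^ k = (HahnSeries.single (k : ℤ) 1 : ℂ⸨X⸩) := by
  have h := HahnSeries.single_pow (Γ := ℤ) (R := ℂ) 1 k 1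
  rw [one_pow, nsmul_eq_mul, mul_one] at h
  rw [x_eq]
  exact h

theorem x_zpow (k : ℤ) : x ^ k = (HahnSeries.single k 1 : ℂ⸨X⸩) := by
  obtain ⟨n, rfl | rfl⟩ := k.eq_nat_or_neg
  · rw [zpow_natCast, x_pow]
  · rw [zpow_neg, zpow_natCast, x_pow]
    refine inv_eq_of_mul_eq_one_right ((HahnSeries.single_mul_single (Γ := ℤ) (R := ℂ)).trans ?_)
    rw [add_neg_cancel, one_mul]
    rfl

theorem coeff_x_zpow_mul (k : ℤ) (f : Laurent) (n : ℤ) :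
    (x ^ k * f).coeff n = f.coeff (n - k) := by
  have h := HahnSeries.coeff_single_mul_add (Γ := ℤ) (R := ℂ) (r := 1) (x := f) (a := n - k)
    (b := k)
  rw [sub_add_cancel, one_mul] at h
  rw [x_zpow]
  exact h

theorem coeff_one (n : ℤ) : (1 : Laurent).coeff n = if n = 0 then 1 else 0 :=
  HahnSeries.coeff_one.trans (by congr)

theorem exists_forall_lt_coeff_eq_zero (f : Laurent) : ∃ k : ℤ, ∀ n < k, f.coeff n = 0 :=
  ⟨HahnSeries.order (f : ℂ⸨X⸩), fun _ hn => HahnSeries.coeff_eq_zero_of_lt_order hn⟩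

theorem coeff_inv_eq_zero {h : Laurent} (h0 : h ≠ 0) (hneg : ∀ n : ℤ, 0 ≤ n → h.coeff n = 0)
    {n : ℤ} (hn : n < 1) : h⁻¹.coeff n = 0 := by
  have order_inv : HahnSeries.order (h : ℂ⸨X⸩) + HahnSeries.order (h⁻¹ : Laurent) = 0 :=
    (HahnSeries.order_mul h0 (inv_ne_zero h0)).symm.trans <|
      (congrArg HahnSeries.order (mul_inv_cancel₀ h0)).trans HahnSeries.order_one
  have order_neg : HahnSeries.order (h : ℂ⸨X⸩) < 0 := by
    by_contra hge
    exact HahnSeries.coeff_order_eq_zero.not.2 h0 (hneg _ (not_lt.1 hge))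
  exact HahnSeries.coeff_eq_zero_of_lt_order (by omega)

end Laurent

/-! ### The field of convergent Laurent series -/

theorem inv_mem_convLaurent {f : Laurent} (hf : f ∈ ConvLaurent) : f⁻¹ ∈ ConvLaurent := by
  obtain ⟨k, g, hg, e⟩ := hf
  rcases eq_or_ne f 0 with rfl | hf0
  · rw [inv_zero]
    exact zero_mem _
  have hg0 : g ≠ 0 := by
    rintro rfl
    rw [map_zero] at e
    exact mul_ne_zero (pow_ne_zero k Laurent.x_ne_zero) hf0 e
  obtain ⟨n, u, hu, hu0, rfl⟩ := exists_convPS_eq_X_pow_mul hg hg0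
  refine ⟨n, PowerSeries.X ^ k * u⁻¹,
    mul_mem (pow_mem X_mem_convPS _) (inv_mem_convPS hu hu0), ?_⟩
  have hofPS (m : ℕ) (v : ℂ⟦X⟧) : ofPS (PowerSeries.X ^ m * v) = Laurent.x ^ m * ofPS v := by
    rw [map_mul, map_pow, Laurent.x]
  have huu : ofPS u * ofPS u⁻¹ = 1 := by
    rw [← map_mul, PowerSeries.mul_inv_cancel _ hu0, map_one]
  rw [hofPS] at e ⊢
  rw [mul_inv_eq_iff_eq_mul₀ hf0]
  calc Laurent.x ^ n = Laurent.x ^ n * ofPS u * ofPS u⁻¹ := by rw [mul_assoc, huu, mul_one]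
    _ = Laurent.x ^ k * f * ofPS u⁻¹ := by rw [e]
    _ = Laurent.x ^ k * ofPS u⁻¹ * f := mul_right_comm ..

theorem isField_convLaurent : IsField ConvLaurent where
  exists_pair_ne := ⟨0, 1, zero_ne_one⟩
  mul_comm := mul_comm
  mul_inv_cancel {f} hf := ⟨⟨_, inv_mem_convLaurent f.2⟩, Subtype.ext <|
    mul_inv_cancel₀ fun h => hf (Subtype.ext h)⟩

instance : Field ConvLaurent := isField_convLaurent.toField

theorem ConvLaurent.x_ne_zero : ConvLaurent.x ≠ 0 := fun h =>
  Laurent.x_ne_zero (congrArg Subtype.val h)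

theorem ConvLaurent.x_mem : ConvLaurent.x ∈ convIntegers := ⟨_, X_mem_convPS, rfl⟩

theorem mem_convIntegers {f : ConvLaurent} :
    f ∈ convIntegers ↔ ∀ n < 0, Laurent.coeff (f : Laurent) n = 0 := by
  rw [← mem_range_ofPS]
  refine ⟨fun ⟨g, _, e⟩ => ⟨g, e⟩, fun ⟨g, hg⟩ => ⟨g, ?_, hg⟩⟩
  obtain ⟨k, g', hg', e⟩ := f.2
  have hgg' : PowerSeries.X ^ k * g = g' := by
    apply ofPS_injective
    rw [← e, map_mul, map_pow]
    exact congrArg (Laurent.x ^ k * ·) hg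
  exact mem_convPS_of_X_pow_mul_mem (hgg' ▸ hg')

/-- The inclusion of `ℂ{x}` in `ℂ{x}[1/x]`, with values in `convIntegers`. -/
def convPSToIntegers : convPS →+* convIntegers where
  toFun g := ⟨⟨ofPS g, 0, g, g.2, by rw [pow_zero, one_mul]⟩, g, g.2, rfl⟩
  map_one' := by ext1; ext1; exact map_one ofPS
  map_zero' := by ext1; ext1; exact map_zero ofPS
  map_mul' _ _ := by ext1; ext1; exact map_mul ofPS _ _
  map_add' _ _ := by ext1; ext1; exact map_add ofPS _ _

instance : IsNoetherianRing convIntegers :=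
  isNoetherianRing_of_surjective convPS convIntegers convPSToIntegers
    fun ⟨_, g, hg, e⟩ => ⟨⟨g, hg⟩, Subtype.ext (Subtype.ext e)⟩

/-! ### The ramified field -/

section Ramification

variable {q : ℕ+}

theorem mem_formalIntegers {f : Ram q} :
    f ∈ formalIntegers q ↔ ∀ n < 0, Laurent.coeff f n = 0 := mem_range_ofPS

instance : IsNoetherianRing (formalIntegers q) :=
  isNoetherianRing_of_surjective ℂ⟦X⟧ _ (ofPS.rangeRestrict : ℂ⟦X⟧ →ₐ[ℂ] ofPS.range).toRingHom
    ofPS.rangeRestrict_surjective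

theorem Ram.y_ne_zero : Ram.y q ≠ 0 := Laurent.x_ne_zero

theorem Ram.coeff_y_zpow_mul (k : ℤ) (f : Ram q) (n : ℤ) :
    Laurent.coeff (Ram.y q ^ k * f) n = Laurent.coeff f (n - k) := Laurent.coeff_x_zpow_mul k f n

theorem Ram.coeff_euler (f : Ram q) (n : ℤ) :
    Laurent.coeff (Ram.euler q f) n = n * Laurent.coeff f n := Laurent.coeff_euler f n

theorem Ram.euler_y : Ram.euler q (Ram.y q) = Ram.y q := by
  have h := Laurent.euler_x_pow 1
  rw [pow_one, Nat.cast_one, one_mul] at h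
  exact h

theorem Ram.exists_eq_add_y_mul {a : Ram q} (ha : a ∈ formalIntegers q) :
    ∃ c : ℂ, ∃ a' ∈ formalIntegers q, a = algebraMap ℂ (Ram q) c + Ram.y q * a' := by
  obtain ⟨g, rfl⟩ := ha
  refine ⟨PowerSeries.constantCoeff g, ofPS (PowerSeries.mk fun n => PowerSeries.coeff (n + 1) g),
    ⟨_, rfl⟩, ?_⟩
  change ofPS g = _
  conv_lhs => rw [PowerSeries.eq_X_mul_shift_add_const g]
  rw [map_add, map_mul, add_comm]
  exact congrArg (· + _) (ofPS.commutes _)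

theorem isUniformizer_formalIntegers (q : ℕ+) : IsUniformizer (formalIntegers q) (Ram.y q) where
  mem := ⟨PowerSeries.X, rfl⟩
  ne_zero := Ram.y_ne_zero
  exists_eq_add_mul _ := Ram.exists_eq_add_y_mul
  exists_zpow_mul_mem f := by
    obtain ⟨k, hk⟩ := Laurent.exists_forall_lt_coeff_eq_zero f
    refine ⟨-k, mem_formalIntegers.2 fun n hn => ?_⟩
    rw [Ram.coeff_y_zpow_mul]
    exact hk _ (by omega)

theorem Ram.euler_mem_formalIntegers {a : Ram q} (ha : a ∈ formalIntegers q) :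
    Ram.euler q a ∈ formalIntegers q := by
  rw [mem_formalIntegers] at ha ⊢
  intro n hn
  rw [Ram.coeff_euler, ha n hn, mul_zero]

theorem Ram.eq_zero_of_forall_zpow_mul_mem {f : Ram q}
    (h : ∀ k : ℕ, Ram.y q ^ (-(k : ℤ)) * f ∈ formalIntegers q) : f = 0 := by
  refine Laurent.ext fun n => ?_
  have hk : n - (n + 1).toNat < 0 := by have := Int.self_le_toNat (n + 1); omega
  have hf := mem_formalIntegers.1 (h (n + 1).toNat) _ hk
  rw [Ram.coeff_y_zpow_mul, sub_neg_eq_add, sub_add_cancel] at hf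
  exact hf

theorem IsPolar.euler_ne_zero {φ : Ram q} (hφ : IsPolar φ) (h0 : φ ≠ 0) : Ram.euler q φ ≠ 0 := by
  intro h
  refine h0 (Laurent.ext fun n => ?_)
  change Laurent.coeff φ n = 0
  rcases eq_or_ne n 0 with rfl | hn
  · exact hφ 0 le_rfl
  · have hc : (0 : ℂ) = n * Laurent.coeff φ n :=
      (congrArg (Laurent.coeff · n) h).symm.trans (Ram.coeff_euler φ n)
    exact (mul_eq_zero.1 hc.symm).resolve_left (by exact_mod_cast hn)

theorem IsPolar.exists_mul_euler_eq_inv {φ : Ram q} (hφ : IsPolar φ) (h0 : φ ≠ 0) :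
    ∃ g ∈ formalIntegers q, g * Ram.euler q φ = (Ram.y q)⁻¹ := by
  have hne := hφ.euler_ne_zero h0
  refine ⟨(Ram.y q)⁻¹ * (Ram.euler q φ)⁻¹, mem_formalIntegers.2 fun n hn => ?_,
    inv_mul_cancel_right₀ hne _⟩
  rw [← zpow_neg_one, Ram.coeff_y_zpow_mul]
  exact Laurent.coeff_inv_eq_zero hne
    (fun m hm => by rw [Ram.coeff_euler, hφ m hm, mul_zero]) (by omega)

theorem coeff_ramify_mul (f : Laurent) (m : ℤ) :
    Laurent.coeff (ramify q f) ((q : ℕ) * m) = f.coeff m :=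
  HahnSeries.embDomain_coeff (a := m)

theorem coeff_ramify_of_not_dvd (f : Laurent) {n : ℤ} (hn : ¬ ((q : ℕ) : ℤ) ∣ n) :
    Laurent.coeff (ramify q f) n = 0 :=
  HahnSeries.embDomain_of_notMem_range fun ⟨m, hm⟩ => hn ⟨m, hm.symm⟩

theorem Ram.algebraMap_eq_ramify (f : ConvLaurent) :
    algebraMap ConvLaurent (Ram q) f = ramify q f := rfl

theorem Ram.algebraMap_x : algebraMap ConvLaurent (Ram q) ConvLaurent.x = Ram.y q ^ (q : ℕ) := by
  have h : ramify q (HahnSeries.single 1 1 : ℂ⸨X⸩) =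
      (HahnSeries.single ((q : ℕ) * 1 : ℤ) 1 : ℂ⸨X⸩) :=
    HahnSeries.embDomain_single
  rw [mul_one, ← Laurent.x_eq, ← Laurent.x_pow] at h
  exact h

theorem Ram.algebraMap_x_zpow (k : ℤ) :
    algebraMap ConvLaurent (Ram q) (ConvLaurent.x ^ k) = Ram.y q ^ ((q : ℕ) * k) := by
  rw [map_zpow₀, Ram.algebraMap_x, ← zpow_natCast, ← zpow_mul]

theorem Ram.algebraMap_mem_formalIntegers {f : ConvLaurent} :
    algebraMap ConvLaurent (Ram q) f ∈ formalIntegers q ↔ f ∈ convIntegers := by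
  rw [mem_formalIntegers, mem_convIntegers, Ram.algebraMap_eq_ramify]
  have hq : (0 : ℤ) < (q : ℕ) := by exact_mod_cast q.pos
  constructor
  · intro h n hn
    rw [← coeff_ramify_mul (q := q)]
    exact h _ (mul_neg_of_pos_of_neg hq hn)
  · intro h n hn
    by_cases hd : ((q : ℕ) : ℤ) ∣ n
    · obtain ⟨m, rfl⟩ := hd
      rw [coeff_ramify_mul]
      exact h m (neg_of_mul_neg_right hn hq.le)
    · exact coeff_ramify_of_not_dvd _ hd

/-! ### The projection of `ℂ((y))` on `ℂ((x))` -/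

/-- The projection of `ℂ((y))` on `ℂ((x))` which forgets the powers of `y` whose exponent is not a
multiple of `q`, as a map of sets. Its linear version is `Ram.proj`. -/
def projCoeff (f : Ram q) : Ram q :=
  (⟨fun n => if ((q : ℕ) : ℤ) ∣ n then Laurent.coeff f n else 0,
    (HahnSeries.isPWO_support (f : ℂ⸨X⸩)).mono fun n hn h => hn (by
      change Laurent.coeff f n = 0 at h
      simp only [h, ite_self])⟩ : ℂ⸨X⸩)

theorem coeff_projCoeff (f : Ram q) (n : ℤ) :
    Laurent.coeff (projCoeff f) n = if ((q : ℕ) : ℤ) ∣ n then Laurent.coeff f n else 0 := rfl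

theorem support_projCoeff_subset (f : Ram q) :
    HahnSeries.support (projCoeff f : ℂ⸨X⸩) ⊆ HahnSeries.support (f : ℂ⸨X⸩) := by
  intro n hn h
  change Laurent.coeff f n = 0 at h
  refine hn ?_
  change Laurent.coeff (projCoeff f) n = 0
  rw [coeff_projCoeff, h, ite_self]

theorem coeff_ramify_mul_coeff_projCoeff (f : Laurent) (g : Ram q) (i j : ℤ) :
    Laurent.coeff (ramify q f) i * Laurent.coeff (projCoeff g) j =
      if ((q : ℕ) : ℤ) ∣ i + j then Laurent.coeff (ramify q f) i * Laurent.coeff g j else 0 := by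
  by_cases hi : ((q : ℕ) : ℤ) ∣ i
  · simp only [coeff_projCoeff, Int.dvd_add_right hi, mul_ite, mul_zero]
  · rw [coeff_ramify_of_not_dvd _ hi, zero_mul, zero_mul, ite_self]

theorem projCoeff_ramify_mul (f : Laurent) (g : Ram q) :
    projCoeff (ramify q f * g) = ramify q f * projCoeff g := by
  refine Laurent.ext fun n => ?_
  have hmul : Laurent.coeff (ramify q f * g) n = _ :=
    HahnSeries.coeff_mul (x := (ramify q f : ℂ⸨X⸩)) (y := (g : ℂ⸨X⸩)) (a := n)
  have hmul_proj : Laurent.coeff (ramify q f * projCoeff g) n = _ :=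
    HahnSeries.coeff_mul_right' (x := (ramify q f : ℂ⸨X⸩))
      (y := (projCoeff g : ℂ⸨X⸩)) (a := n) (HahnSeries.isPWO_support _)
      (support_projCoeff_subset g)
  rw [coeff_projCoeff, hmul, hmul_proj]
  refine Eq.trans ?_ (Finset.sum_congr rfl fun p hp =>
    (coeff_ramify_mul_coeff_projCoeff f g p.1 p.2).trans
      (by rw [(Finset.mem_antidiagonal.1 hp).2.2])).symm
  split_ifs
  · rfl
  · rw [Finset.sum_const_zero]

/-- The `ℂ((x))`-linear projection of `ℂ((y))` on `ℂ((x))`. -/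
def Ram.proj (q : ℕ+) : Ram q →ₗ[ConvLaurent] Ram q where
  toFun := projCoeff
  map_add' f g := Laurent.ext fun n => by
    change Laurent.coeff (projCoeff (f + g)) n =
      Laurent.coeff (projCoeff f) n + Laurent.coeff (projCoeff g) n
    simp only [coeff_projCoeff]
    split_ifs
    · rfl
    · rw [add_zero]
  map_smul' c f := by
    rw [Algebra.smul_def, Ram.algebraMap_eq_ramify, projCoeff_ramify_mul]
    rfl

theorem Ram.coeff_proj (f : Ram q) (n : ℤ) :
    Laurent.coeff (Ram.proj q f) n = if ((q : ℕ) : ℤ) ∣ n then Laurent.coeff f n else 0 := rfl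

theorem Ram.proj_one : Ram.proj q 1 = 1 := by
  refine Laurent.ext fun n => ?_
  change Laurent.coeff (Ram.proj q 1) n = Laurent.coeff 1 n
  rw [Ram.coeff_proj]
  change (if _ then Laurent.coeff 1 n else 0) = _
  rw [Laurent.coeff_one]
  aesop

theorem Ram.proj_euler (f : Ram q) : Ram.proj q (Ram.euler q f) = Ram.euler q (Ram.proj q f) := by
  refine Laurent.ext fun n => ?_
  rw [Ram.coeff_proj, Ram.coeff_euler, Ram.coeff_euler, Ram.coeff_proj, mul_ite, mul_zero]

theorem Ram.proj_mem_formalIntegers {f : Ram q} (hf : f ∈ formalIntegers q) :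
    Ram.proj q f ∈ formalIntegers q := by
  rw [mem_formalIntegers] at hf ⊢
  intro n hn
  rw [Ram.coeff_proj, hf n hn, ite_self]

theorem exists_convIntegers_coeff_eq {k : ℕ} (c : ℕ → ℂ) :
    ∃ a ∈ convIntegers, ∀ n : ℕ, n < k → Laurent.coeff (a : Laurent) n = c n := by
  let p : ℂ⟦X⟧ := PowerSeries.mk fun n => if n < k then c n else 0
  have hp : p ∈ convPS := by
    refine ⟨1, one_pos, summable_of_ne_finset_zero (s := Finset.range k) fun n hn => ?_⟩
    rw [PowerSeries.coeff_mk, if_neg (by simpa using hn), norm_zero, zero_mul]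
  refine ⟨convPSToIntegers ⟨p, hp⟩, (convPSToIntegers _).2, fun n hn => ?_⟩
  change Laurent.coeff (ofPS p) n = c n
  rw [coeff_ofPS_natCast, PowerSeries.coeff_mk, if_pos hn]

theorem Ram.exists_zpow_mul_proj_sub_mem {g : Ram q} (hg : g ∈ formalIntegers q) (k : ℕ) :
    ∃ a ∈ convIntegers, Ram.y q ^ (-((q : ℕ) * k : ℤ)) *
      (Ram.proj q g - algebraMap ConvLaurent (Ram q) a) ∈ formalIntegers q := by
  obtain ⟨a, ha, hag⟩ := exists_convIntegers_coeff_eq (k := k)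
    fun n => Laurent.coeff g ((q : ℕ) * (n : ℤ))
  refine ⟨a, ha, ?_⟩
  rw [mem_formalIntegers] at hg ⊢
  rw [mem_convIntegers] at ha
  intro n hn
  rw [Ram.coeff_y_zpow_mul, sub_neg_eq_add]
  change Laurent.coeff (Ram.proj q g) (n + (q : ℕ) * k) -
    Laurent.coeff (ramify q a) (n + (q : ℕ) * k) = 0
  have hq : (0 : ℤ) < (q : ℕ) := by exact_mod_cast q.pos
  rw [Ram.coeff_proj, sub_eq_zero]
  split_ifs with hd
  · obtain ⟨m, hm⟩ := hd
    rw [hm, coeff_ramify_mul]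
    rcases lt_or_ge m 0 with hm0 | hm0
    · rw [ha m hm0, hg _ (mul_neg_of_pos_of_neg hq hm0)]
    · lift m to ℕ using hm0
      have hmk : (m : ℤ) < k := lt_of_mul_lt_mul_left (by omega) hq.le
      rw [hag m (by exact_mod_cast hmk)]
  · rw [coeff_ramify_of_not_dvd _ hd]

end Ramification

/-! ### The formalized pull-back -/

namespace Connection

section Pullback

variable {M : Type*} [AddCommGroup M] [Module ConvLaurent M] {q : ℕ+}

/-- The map `m ↦ 1 ⊗ m`. -/
abbrev unitMap (q : ℕ+) (M : Type*) [AddCommGroup M] [Module ConvLaurent M] :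
    M →ₗ[ConvLaurent] Ram q ⊗[ConvLaurent] M := TensorProduct.mk ConvLaurent (Ram q) M 1

theorem unitMap_smul (f : ConvLaurent) (m : M) :
    unitMap q M (f • m) = algebraMap ConvLaurent (Ram q) f • unitMap q M m := by
  rw [map_smul, algebraMap_smul]

theorem unitMap_x_zpow_smul (k : ℤ) (m : M) :
    unitMap q M (ConvLaurent.x ^ k • m) = Ram.y q ^ ((q : ℕ) * k : ℤ) • unitMap q M m := by
  rw [unitMap_smul, Ram.algebraMap_x_zpow]

/-- The projection of `ℂ((y)) ⊗ M` on `ℂ((x)) ⊗ M` induced by `Ram.proj`. -/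
def invariantProj (q : ℕ+) (M : Type*) [AddCommGroup M] [Module ConvLaurent M] :
    Ram q ⊗[ConvLaurent] M →ₗ[ConvLaurent] Ram q ⊗[ConvLaurent] M :=
  TensorProduct.map (Ram.proj q) LinearMap.id

theorem invariantProj_tmul (g : Ram q) (m : M) :
    invariantProj q M (g ⊗ₜ m) = Ram.proj q g ⊗ₜ m := rfl

theorem invariantProj_smul_unitMap (g : Ram q) (m : M) :
    invariantProj q M (g • unitMap q M m) = Ram.proj q g • unitMap q M m := by
  simp only [TensorProduct.mk_apply, TensorProduct.smul_tmul', smul_eq_mul, mul_one,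
    invariantProj_tmul]

theorem invariantProj_unitMap (m : M) : invariantProj q M (unitMap q M m) = unitMap q M m := by
  simpa only [one_smul, Ram.proj_one] using invariantProj_smul_unitMap (1 : Ram q) m

theorem invariantProj_y_zpow_smul (k : ℤ) (n : Ram q ⊗[ConvLaurent] M) :
    invariantProj q M (Ram.y q ^ ((q : ℕ) * k : ℤ) • n) =
      Ram.y q ^ ((q : ℕ) * k : ℤ) • invariantProj q M n := by
  rw [← Ram.algebraMap_x_zpow, algebraMap_smul, map_smul, algebraMap_smul]

section BasisLattice

variable {ι : Type*} (B : Module.Basis ι ConvLaurent M)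

/-- The lattice of `ℂ((y)) ⊗ M` generated by a basis of `M`. -/
def basisLattice (q : ℕ+) : Submodule (formalIntegers q) (Ram q ⊗[ConvLaurent] M) where
  carrier := {n | ∀ i, (B.baseChange (Ram q)).repr n i ∈ formalIntegers q}
  add_mem' h h' i := by
    rw [map_add, Finsupp.add_apply]
    exact add_mem (h i) (h' i)
  zero_mem' i := by
    rw [map_zero, Finsupp.zero_apply]
    exact zero_mem _
  smul_mem' a n h i := by
    have hsmul : (B.baseChange (Ram q)).repr (a • n) =
        (a : Ram q) • (B.baseChange (Ram q)).repr n :=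
      map_smul (B.baseChange (Ram q)).repr (a : Ram q) n
    rw [hsmul, Finsupp.smul_apply]
    exact mul_mem a.2 (h i)

theorem mem_zpowLattice_basisLattice {k : ℤ} {n : Ram q ⊗[ConvLaurent] M} :
    n ∈ zpowLattice (Ram.y q) (basisLattice B q) k ↔
      ∀ i, Ram.y q ^ (-k) * (B.baseChange (Ram q)).repr n i ∈ formalIntegers q := by
  change (∀ i, (B.baseChange (Ram q)).repr (Ram.y q ^ (-k) • n) i ∈ _) ↔ _
  simp only [map_smul, Finsupp.smul_apply, smul_eq_mul]

theorem span_basisLattice :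
    Submodule.span (Ram q) (basisLattice B q : Set (Ram q ⊗[ConvLaurent] M)) = ⊤ := by
  classical
  rw [eq_top_iff, ← (B.baseChange (Ram q)).span_eq]
  refine Submodule.span_mono ?_
  rintro _ ⟨i, rfl⟩ j
  rw [Module.Basis.repr_self, Finsupp.single_apply]
  split_ifs
  exacts [one_mem _, zero_mem _]

theorem eq_zero_of_forall_mem_zpowLattice_basisLattice {n : Ram q ⊗[ConvLaurent] M}
    (h : ∀ k : ℕ, n ∈ zpowLattice (Ram.y q) (basisLattice B q) k) : n = 0 := by
  refine (B.baseChange (Ram q)).repr.injective (Finsupp.ext fun i => ?_)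
  rw [map_zero, Finsupp.zero_apply]
  exact Ram.eq_zero_of_forall_zpow_mul_mem fun k => (mem_zpowLattice_basisLattice B).1 (h k) i

theorem repr_invariantProj (n : Ram q ⊗[ConvLaurent] M) (i : ι) :
    (B.baseChange (Ram q)).repr (invariantProj q M n) i =
      Ram.proj q ((B.baseChange (Ram q)).repr n i) := by
  induction n using TensorProduct.induction_on with
  | zero => simp
  | tmul g m =>
    rw [invariantProj_tmul, Module.Basis.baseChange_repr_tmul, Module.Basis.baseChange_repr_tmul,
      map_smul]
  | add a b ha hb => simp only [map_add, Finsupp.add_apply, ha, hb]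

theorem invariantProj_mem_zpowLattice_basisLattice {k : ℤ} {n : Ram q ⊗[ConvLaurent] M}
    (hn : n ∈ zpowLattice (Ram.y q) (basisLattice B q) ((q : ℕ) * k)) :
    invariantProj q M n ∈ zpowLattice (Ram.y q) (basisLattice B q) ((q : ℕ) * k) := by
  rw [mem_zpowLattice, ← mul_neg] at hn ⊢
  rw [← invariantProj_y_zpow_smul]
  intro i
  rw [repr_invariantProj]
  exact Ram.proj_mem_formalIntegers (hn i)

end BasisLattice

end Pullback

section ConvergentLattice

theorem mem_zpowLattice_span_range_of_unitMap_mem {M : Type*} [AddCommGroup M] [Module ℂ M]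
    [Module ConvLaurent M] [IsScalarTower ℂ ConvLaurent M] {q : ℕ+} {ι : Type*} [Finite ι]
    (B : Module.Basis ι ConvLaurent M) {k : ℤ} {m : M}
    (hm : unitMap q M m ∈ zpowLattice (Ram.y q) (basisLattice B q) ((q : ℕ) * k)) :
    m ∈ zpowLattice ConvLaurent.x (Submodule.span convIntegers (Set.range B)) k := by
  have := Fintype.ofFinite ι
  rw [mem_zpowLattice, ← mul_neg, ← unitMap_x_zpow_smul] at hm
  rw [mem_zpowLattice, ← B.sum_repr (ConvLaurent.x ^ (-k) • m)]
  refine sum_mem fun i _ => ?_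
  have repr_mem := hm i
  rw [TensorProduct.mk_apply, Module.Basis.baseChange_repr_tmul,
    ← Algebra.algebraMap_eq_smul_one, Ram.algebraMap_mem_formalIntegers] at repr_mem
  exact Submodule.smul_mem _ (⟨_, repr_mem⟩ : convIntegers) (Submodule.subset_span ⟨i, rfl⟩)

end ConvergentLattice

section Euler

variable {M : Type*} [AddCommGroup M] [Module ℂ M] [Module ConvLaurent M]
  [IsScalarTower ℂ ConvLaurent M] (C : Connection M) {q : ℕ+}

theorem unitMap_complex_smul (c : ℂ) (m : M) :
    unitMap q M (c • m) = c • unitMap q M m := by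
  rw [← algebraMap_smul ConvLaurent c m, map_smul, algebraMap_smul]

theorem pullbackEuler_smul (f : Ram q) (n : Ram q ⊗[ConvLaurent] M) :
    C.pullbackEuler q (f • n) = Ram.euler q f • n + f • C.pullbackEuler q n := by
  induction n using TensorProduct.induction_on with
  | zero => simp
  | tmul g m =>
    simp only [TensorProduct.smul_tmul', pullbackEuler_tmul, smul_eq_mul, Ram.euler_mul,
      TensorProduct.add_tmul, smul_add, add_assoc]
  | add a b ha hb =>
    rw [smul_add, map_add, ha, hb, map_add, smul_add, smul_add]
    abel

theorem pullbackEuler_unitMap (m : M) :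
    C.pullbackEuler q (unitMap q M m) = ((q : ℕ) : ℂ) • unitMap q M (C.euler m) := by
  have euler_one : Ram.euler q 1 = 0 := by simpa using Ram.euler_mul q 1 1
  rw [TensorProduct.mk_apply, pullbackEuler_tmul, euler_one, TensorProduct.zero_tmul, zero_add,
    TensorProduct.tmul_smul, Nat.cast_smul_eq_nsmul]
  rfl

theorem invariantProj_pullbackEuler (n : Ram q ⊗[ConvLaurent] M) :
    invariantProj q M (C.pullbackEuler q n) = C.pullbackEuler q (invariantProj q M n) := by
  induction n using TensorProduct.induction_on with
  | zero => simp
  | tmul g m =>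
    rw [pullbackEuler_tmul, map_add, invariantProj_tmul, invariantProj_tmul, invariantProj_tmul,
      pullbackEuler_tmul, Ram.proj_euler]
  | add a b ha hb => simp only [map_add, ha, hb]

theorem isEulerOperator_pullbackEuler (q : ℕ+) :
    IsEulerOperator (Ram.y q) (C.pullbackEuler q) := fun n => by
  rw [pullbackEuler_smul, Ram.euler_y]

variable {C} in
theorem twistedEuler_smul {W : Submodule (Ram q) (Ram q ⊗[ConvLaurent] M)}
    (hW : ∀ n ∈ W, C.pullbackEuler q n ∈ W) (φ f : Ram q) (n : W) :
    C.twistedEuler W hW φ (f • n) = Ram.euler q f • n + f • C.twistedEuler W hW φ n := by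
  ext
  change C.pullbackEuler q (f • (n : Ram q ⊗[ConvLaurent] M)) -
      Ram.euler q φ • f • (n : Ram q ⊗[ConvLaurent] M) =
    Ram.euler q f • (n : Ram q ⊗[ConvLaurent] M) + f • (C.pullbackEuler q n -
      Ram.euler q φ • (n : Ram q ⊗[ConvLaurent] M))
  rw [pullbackEuler_smul, smul_sub, smul_comm f, add_sub_assoc]

variable {C} in
theorem isEulerOperator_twistedEuler {W : Submodule (Ram q) (Ram q ⊗[ConvLaurent] M)}
    (hW : ∀ n ∈ W, C.pullbackEuler q n ∈ W) (φ : Ram q) :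
    IsEulerOperator (E := W) (Ram.y q) (C.twistedEuler W hW φ) := fun n => by
  rw [twistedEuler_smul, Ram.euler_y]

end Euler

section FormalSpan

variable {M : Type*} [AddCommGroup M] [Module ℂ M] [Module ConvLaurent M] {q : ℕ+}
  {U : Submodule ℂ M}

/-- The `ℂ[[y]]`-submodule of `ℂ((y)) ⊗ M` generated by a subspace of `M`. -/
def formalSpan (q : ℕ+) (U : Submodule ℂ M) :
    Submodule (formalIntegers q) (Ram q ⊗[ConvLaurent] M) :=
  Submodule.span (formalIntegers q) (unitMap q M '' U)

theorem unitMap_mem_formalSpan {m : M} (hm : m ∈ U) : unitMap q M m ∈ formalSpan q U :=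
  Submodule.subset_span ⟨m, hm, rfl⟩

theorem span_formalSpan (hU : ∀ m, ∃ k : ℤ, ConvLaurent.x ^ k • m ∈ U) :
    Submodule.span (Ram q) (formalSpan q U : Set (Ram q ⊗[ConvLaurent] M)) = ⊤ := by
  refine eq_top_iff.2 fun n _ => ?_
  induction n using TensorProduct.induction_on with
  | zero => exact zero_mem _
  | add a b ha hb => exact add_mem (ha trivial) (hb trivial)
  | tmul g m =>
    obtain ⟨k, hk⟩ := hU m
    have hgm : g ⊗ₜ m = (g * Ram.y q ^ (-((q : ℕ) * k) : ℤ)) •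
        unitMap q M (ConvLaurent.x ^ k • m) := by
      rw [unitMap_x_zpow_smul, smul_smul, mul_assoc, ← zpow_add₀ Ram.y_ne_zero,
        neg_add_cancel, zpow_zero, mul_one, TensorProduct.mk_apply, TensorProduct.smul_tmul',
        smul_eq_mul, mul_one]
    rw [hgm]
    exact Submodule.smul_mem _ _ (Submodule.subset_span (unitMap_mem_formalSpan hk))

theorem invariantProj_mem_formalSpan {n : Ram q ⊗[ConvLaurent] M} (hn : n ∈ formalSpan q U) :
    invariantProj q M n ∈ formalSpan q U := by
  induction hn using Submodule.closure_induction with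
  | zero => rw [map_zero]; exact zero_mem _
  | add a b _ _ ha hb => rw [map_add]; exact add_mem ha hb
  | smul_mem g x hx =>
    obtain ⟨m, hm, rfl⟩ := hx
    change invariantProj q M ((g : Ram q) • unitMap q M m) ∈ _
    rw [invariantProj_smul_unitMap]
    exact Submodule.smul_mem _ (⟨_, Ram.proj_mem_formalIntegers g.2⟩ : formalIntegers q)
      (unitMap_mem_formalSpan hm)

theorem pullbackEuler_mem_formalSpan [IsScalarTower ℂ ConvLaurent M] {C : Connection M}
    (hU : ∀ m ∈ U, C.euler m ∈ U) {n : Ram q ⊗[ConvLaurent] M} (hn : n ∈ formalSpan q U) :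
    C.pullbackEuler q n ∈ formalSpan q U := by
  induction hn using Submodule.closure_induction with
  | zero => rw [map_zero]; exact zero_mem _
  | add a b _ _ ha hb => rw [map_add]; exact add_mem ha hb
  | smul_mem g x hx =>
    obtain ⟨m, hm, rfl⟩ := hx
    change C.pullbackEuler q ((g : Ram q) • unitMap q M m) ∈ _
    rw [pullbackEuler_smul, pullbackEuler_unitMap, ← unitMap_complex_smul]
    exact add_mem
      (Submodule.smul_mem _ (⟨_, Ram.euler_mem_formalIntegers g.2⟩ : formalIntegers q)
        (unitMap_mem_formalSpan hm))
      (Submodule.smul_mem _ g (unitMap_mem_formalSpan (U.smul_mem _ (hU m hm))))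

end FormalSpan

namespace ElementaryModel

variable {M : Type*} [AddCommGroup M] [Module ℂ M] [Module ConvLaurent M]
  [IsScalarTower ℂ ConvLaurent M] {C : Connection M} {q : ℕ+} (S : C.ElementaryModel q)

/-! ### The summands of an elementary model -/

section Component

theorem isInternal_summand [DecidableEq S.Φ] : DirectSum.IsInternal S.summand :=
  DirectSum.isInternal_submodule_of_iSupIndep_of_iSup_eq_top S.independent S.iSup_eq_top

open scoped Classical in
/-- The decomposition of `ℂ((y)) ⊗ M` into the summands of the model. -/
abbrev decomposition : DirectSum.Decomposition S.summand :=
  S.isInternal_summand.chooseDecomposition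

open scoped Classical in
/-- The component in the `φ`-summand. -/
def component (φ : S.Φ) : Ram q ⊗[ConvLaurent] M →ₗ[Ram q] S.summand φ :=
  letI := S.decomposition
  DirectSum.component (Ram q) S.Φ (fun φ => S.summand φ) φ ∘ₗ
    (DirectSum.decomposeLinearEquiv S.summand).toLinearMap

theorem component_coe (φ : S.Φ) (s : S.summand φ) : S.component φ s = s := by
  classical
  let := S.decomposition
  exact Subtype.ext (DirectSum.decompose_of_mem_same S.summand s.2)

theorem component_coe_of_ne {φ ψ : S.Φ} (h : φ ≠ ψ) (s : S.summand φ) : S.component ψ s = 0 := by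
  classical
  let := S.decomposition
  exact Subtype.ext (DirectSum.decompose_of_mem_ne S.summand s.2 h)

theorem sum_component (n : Ram q ⊗[ConvLaurent] M) :
    ∑ φ, (S.component φ n : Ram q ⊗[ConvLaurent] M) = n := by
  classical
  let := S.decomposition
  conv_rhs => rw [← (DirectSum.decompose S.summand).symm_apply_apply n,
    ← DirectSum.sum_univ_of (DirectSum.decompose S.summand n), DirectSum.decompose_symm_sum]
  exact Finset.sum_congr rfl fun φ _ => (DirectSum.decompose_symm_of S.summand _).symm

/-- The operator `y∂_y` of the regular part `R_φ`. -/
abbrev regularEuler (φ : S.Φ) : Module.End ℂ (S.summand φ) :=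
  C.twistedEuler (S.summand φ) (S.stable φ) φ

theorem pullbackEuler_coe (φ : S.Φ) (s : S.summand φ) :
    C.pullbackEuler q (s : Ram q ⊗[ConvLaurent] M) =
      (S.regularEuler φ s + Ram.euler q φ • s : S.summand φ) :=
  (sub_add_cancel (C.pullbackEuler q (s : Ram q ⊗[ConvLaurent] M))
    (Ram.euler q φ • (s : Ram q ⊗[ConvLaurent] M))).symm

theorem component_pullbackEuler (φ : S.Φ) (n : Ram q ⊗[ConvLaurent] M) :
    S.component φ (C.pullbackEuler q n) =
      S.regularEuler φ (S.component φ n) + Ram.euler q φ • S.component φ n := by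
  conv_lhs => rw [← S.sum_component n, map_sum, map_sum]
  rw [Finset.sum_eq_single_of_mem φ (Finset.mem_univ φ) fun ψ _ hψ => ?_,
    S.pullbackEuler_coe, S.component_coe]
  rw [S.pullbackEuler_coe, S.component_coe_of_ne hψ]

theorem component_pullbackEuler_of_eq_zero {φ : S.Φ} (hφ : (φ : Ram q) = 0)
    (n : Ram q ⊗[ConvLaurent] M) :
    S.component φ (C.pullbackEuler q n) = S.regularEuler φ (S.component φ n) := by
  rw [component_pullbackEuler, hφ, map_zero, zero_smul, add_zero]

/-- The regular part `R_0` of `ℂ((y)) ⊗ M`, cut out by the vanishing of the components of index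
`φ ≠ 0`; it is zero if `0 ∉ Φ`. -/
def regularPart : Submodule (Ram q) (Ram q ⊗[ConvLaurent] M) :=
  ⨅ φ : {φ : S.Φ // (φ : Ram q) ≠ 0}, LinearMap.ker (S.component φ.1)

/-- The irregular part of `ℂ((y)) ⊗ M`: the sum of the summands of index `φ ≠ 0`. -/
def irregularPart : Submodule (Ram q) (Ram q ⊗[ConvLaurent] M) :=
  ⨅ φ : {φ : S.Φ // (φ : Ram q) = 0}, LinearMap.ker (S.component φ.1)

theorem mem_regularPart {n : Ram q ⊗[ConvLaurent] M} :
    n ∈ S.regularPart ↔ ∀ φ : S.Φ, (φ : Ram q) ≠ 0 → S.component φ n = 0 := by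
  simp only [regularPart, Submodule.mem_iInf, Subtype.forall, LinearMap.mem_ker]

theorem mem_irregularPart {n : Ram q ⊗[ConvLaurent] M} :
    n ∈ S.irregularPart ↔ ∀ φ : S.Φ, (φ : Ram q) = 0 → S.component φ n = 0 := by
  simp only [irregularPart, Submodule.mem_iInf, Subtype.forall, LinearMap.mem_ker]

theorem coe_mem_regularPart {φ : S.Φ} (hφ : (φ : Ram q) = 0) (s : S.summand φ) :
    (s : Ram q ⊗[ConvLaurent] M) ∈ S.regularPart :=
  S.mem_regularPart.2 fun ψ hψ =>
    S.component_coe_of_ne (by rintro rfl; exact hψ hφ) s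

theorem coe_mem_irregularPart {φ : S.Φ} (hφ : (φ : Ram q) ≠ 0) (s : S.summand φ) :
    (s : Ram q ⊗[ConvLaurent] M) ∈ S.irregularPart :=
  S.mem_irregularPart.2 fun ψ hψ =>
    S.component_coe_of_ne (by rintro rfl; exact hφ hψ) s

theorem exists_regular_add_irregular (n : Ram q ⊗[ConvLaurent] M) :
    ∃ r ∈ S.regularPart, ∃ i ∈ S.irregularPart, r + i = n := by
  rw [← Submodule.mem_sup, ← S.sum_component n]
  refine sum_mem fun φ _ => ?_
  by_cases hφ : (φ : Ram q) = 0
  · exact Submodule.mem_sup_left (S.coe_mem_regularPart hφ _)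
  · exact Submodule.mem_sup_right (S.coe_mem_irregularPart hφ _)

theorem pullbackEuler_mem_regularPart {n : Ram q ⊗[ConvLaurent] M} (hn : n ∈ S.regularPart) :
    C.pullbackEuler q n ∈ S.regularPart := by
  rw [mem_regularPart] at hn ⊢
  intro φ hφ
  rw [component_pullbackEuler, hn φ hφ, map_zero, smul_zero, add_zero]

end Component

/-! ### The Deligne filtrations of the regular parts -/

theorem regularV_spec (φ : S.Φ) :
    IsDeligneFiltration (E := S.summand φ) (formalIntegers q) (Ram.y q) (S.regularEuler φ)
      (S.regularV φ) ∧
    ∃ L : Submodule (formalIntegers q) (S.summand φ), L.FG ∧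
      ∀ b, ∃ k : ℤ, S.regularV φ b ≤ zpowLattice (E := S.summand φ) (Ram.y q) L k := by
  obtain ⟨L, hfg, hspan, hL⟩ := S.regular φ
  obtain ⟨V, hV, hle⟩ := exists_isDeligneFiltration (E := S.summand φ)
    (isUniformizer_formalIntegers q) (isEulerOperator_twistedEuler (S.stable φ) φ) hL hfg hspan
  have regularV_eq : S.regularV φ = V := hV.deligne_eq
  exact regularV_eq ▸ ⟨hV, L, hfg, hle⟩

theorem isDeligneFiltration_regularV (φ : S.Φ) :
    IsDeligneFiltration (E := S.summand φ) (formalIntegers q) (Ram.y q) (S.regularEuler φ)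
      (S.regularV φ) :=
  (S.regularV_spec φ).1

theorem exists_regularV_le (φ : S.Φ) (b : ℝ)
    {W : Submodule (formalIntegers q) (Ram q ⊗[ConvLaurent] M)}
    (hW : Submodule.span (Ram q) (W : Set (Ram q ⊗[ConvLaurent] M)) = ⊤) :
    ∃ k : ℤ, ∀ s ∈ S.regularV φ b,
      (s : Ram q ⊗[ConvLaurent] M) ∈ zpowLattice (Ram.y q) W k := by
  obtain ⟨L, hfg, hle⟩ := (S.regularV_spec φ).2
  obtain ⟨k, hk⟩ := hle b
  obtain ⟨l, hl⟩ := exists_map_mem_zpowLattice (E₀ := S.summand φ)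
    (isUniformizer_formalIntegers q) hW hfg (S.summand φ).subtype
  refine ⟨l + k, fun s hs => ?_⟩
  have hks : Ram.y q ^ (-k) • (s : Ram q ⊗[ConvLaurent] M) ∈ zpowLattice (Ram.y q) W l :=
    hl _ (hk hs)
  rwa [zpow_smul_mem_zpowLattice Ram.y_ne_zero, sub_neg_eq_add] at hks

theorem zpow_smul_mem_regularV (φ : S.Φ) {b : ℝ} (k : ℤ) {s : S.summand φ} :
    Ram.y q ^ k • s ∈ S.regularV φ (b + k) ↔ s ∈ S.regularV φ b :=
  (S.isDeligneFiltration_regularV φ).zpow_smul_mem Ram.y_ne_zero k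

theorem eq_zero_of_forall_mem_regularV [Module.Finite ConvLaurent M] (φ : S.Φ) (b : ℝ)
    {s : S.summand φ} (h : ∀ k : ℕ, s ∈ S.regularV φ (b + k)) : s = 0 := by
  let B := Module.finBasis ConvLaurent M
  obtain ⟨l, hl⟩ := S.exists_regularV_le φ b (span_basisLattice B)
  have mem_zpowLattice (k : ℕ) :
      (s : Ram q ⊗[ConvLaurent] M) ∈ zpowLattice (Ram.y q) (basisLattice B q) k := by
    have hs : Ram.y q ^ (-((k - l).toNat : ℤ)) • s ∈ S.regularV φ b := by
      rw [← S.zpow_smul_mem_regularV φ ((k - l).toNat : ℤ), smul_smul, ← zpow_add₀ Ram.y_ne_zero,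
        add_neg_cancel, zpow_zero, one_smul]
      exact_mod_cast h (k - l).toNat
    have hls := hl _ hs
    rw [Submodule.coe_smul, zpow_smul_mem_zpowLattice Ram.y_ne_zero] at hls
    exact zpowLattice_antitone (isUniformizer_formalIntegers q) _
      (by have := Int.self_le_toNat (k - l); lia) hls
  exact Subtype.ext (eq_zero_of_forall_mem_zpowLattice_basisLattice B mem_zpowLattice)

/-! ### The formal parabolic filtration and the formal Deligne filtration -/

section FormalFiltrations

theorem mem_formalParabolic {b : ℝ} {n : Ram q ⊗[ConvLaurent] M} :
    n ∈ S.formalParabolic b ↔ ∀ φ, S.component φ n ∈ S.regularV φ b := by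
  refine ⟨fun hn φ => ?_, fun h => ?_⟩
  · have le_comap : S.formalParabolic b ≤
        (S.regularV φ b).comap ((S.component φ).restrictScalars ℂ) := by
      refine iSup_le fun ψ => ?_
      rintro _ ⟨s, hs, rfl⟩
      change S.component φ s ∈ S.regularV φ b
      obtain rfl | hψ := eq_or_ne ψ φ
      · rwa [component_coe]
      · exact S.component_coe_of_ne hψ s ▸ zero_mem _
    exact le_comap hn
  · rw [← S.sum_component n]
    exact sum_mem fun φ _ => Submodule.mem_iSup_of_mem φ ⟨_, h φ, rfl⟩

theorem formalParabolic_antitone : Antitone S.formalParabolic := fun _ _ hbc _ hn =>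
  S.mem_formalParabolic.2 fun φ =>
    (S.isDeligneFiltration_regularV φ).antitone hbc (S.mem_formalParabolic.1 hn φ)

theorem exists_mem_formalParabolic (n : Ram q ⊗[ConvLaurent] M) :
    ∃ b, n ∈ S.formalParabolic b := by
  choose f hf using fun φ => (S.isDeligneFiltration_regularV φ).exhaustive (S.component φ n)
  obtain ⟨b, hb⟩ := (Set.finite_range f).bddBelow
  exact ⟨b, S.mem_formalParabolic.2 fun φ =>
    (S.isDeligneFiltration_regularV φ).antitone (hb ⟨φ, rfl⟩) (hf φ)⟩

theorem smul_mem_formalParabolic {b : ℝ} {a : Ram q} (ha : a ∈ formalIntegers q)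
    {n : Ram q ⊗[ConvLaurent] M} (hn : n ∈ S.formalParabolic b) :
    a • n ∈ S.formalParabolic b :=
  S.mem_formalParabolic.2 fun φ => by
    rw [map_smul]
    exact (S.isDeligneFiltration_regularV φ).smul_mem ha (S.mem_formalParabolic.1 hn φ)

theorem zpow_smul_mem_formalParabolic {b : ℝ} (k : ℤ) {n : Ram q ⊗[ConvLaurent] M} :
    Ram.y q ^ k • n ∈ S.formalParabolic (b + k) ↔ n ∈ S.formalParabolic b := by
  simp only [mem_formalParabolic, map_smul, zpow_smul_mem_regularV]

theorem exists_zpow_smul_mem_formalParabolic (b : ℝ) (n : Ram q ⊗[ConvLaurent] M) :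
    ∃ k : ℕ, Ram.y q ^ ((q : ℕ) * k : ℤ) • n ∈ S.formalParabolic b := by
  obtain ⟨c, hc⟩ := S.exists_mem_formalParabolic n
  obtain ⟨k, hk⟩ := exists_nat_ge (b - c)
  refine ⟨k, S.formalParabolic_antitone ?_ ((S.zpow_smul_mem_formalParabolic _).2 hc)⟩
  have hqk : (k : ℝ) ≤ (q : ℕ) * k :=
    le_mul_of_one_le_left (Nat.cast_nonneg k) (by exact_mod_cast q.pos)
  push_cast
  linarith

/-- The filtration `V^b` of `ℂ((y)) ⊗ M`: the Deligne filtration on the regular part, and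
everything on the irregular part. -/
def formalV (b : ℝ) : Submodule ℂ (Ram q ⊗[ConvLaurent] M) :=
  ⨅ φ : {φ : S.Φ // (φ : Ram q) = 0},
    (S.regularV φ.1 b).comap ((S.component φ.1).restrictScalars ℂ)

theorem mem_formalV {b : ℝ} {n : Ram q ⊗[ConvLaurent] M} :
    n ∈ S.formalV b ↔ ∀ φ : S.Φ, (φ : Ram q) = 0 → S.component φ n ∈ S.regularV φ b := by
  simp only [formalV, Submodule.mem_iInf, Subtype.forall]
  rfl

theorem formalParabolic_le_formalV (b : ℝ) : S.formalParabolic b ≤ S.formalV b := fun _ hn =>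
  S.mem_formalV.2 fun φ _ => S.mem_formalParabolic.1 hn φ

theorem mem_formalV_of_mem_irregularPart {n : Ram q ⊗[ConvLaurent] M}
    (hn : n ∈ S.irregularPart) (b : ℝ) : n ∈ S.formalV b :=
  S.mem_formalV.2 fun φ hφ => S.mem_irregularPart.1 hn φ hφ ▸ zero_mem _

theorem mem_formalParabolic_of_mem_regularPart {b : ℝ} {n : Ram q ⊗[ConvLaurent] M}
    (hn : n ∈ S.regularPart) (hV : n ∈ S.formalV b) : n ∈ S.formalParabolic b := by
  refine S.mem_formalParabolic.2 fun φ => ?_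
  by_cases hφ : (φ : Ram q) = 0
  · exact S.mem_formalV.1 hV φ hφ
  · exact S.mem_regularPart.1 hn φ hφ ▸ zero_mem _

theorem smul_mem_formalV {b : ℝ} {a : Ram q} (ha : a ∈ formalIntegers q)
    {n : Ram q ⊗[ConvLaurent] M} (hn : n ∈ S.formalV b) : a • n ∈ S.formalV b :=
  S.mem_formalV.2 fun φ hφ => by
    rw [map_smul]
    exact (S.isDeligneFiltration_regularV φ).smul_mem ha (S.mem_formalV.1 hn φ hφ)

theorem pullbackEuler_mem_formalV {b : ℝ} {n : Ram q ⊗[ConvLaurent] M} (hn : n ∈ S.formalV b) :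
    C.pullbackEuler q n ∈ S.formalV b :=
  S.mem_formalV.2 fun φ hφ => by
    rw [S.component_pullbackEuler_of_eq_zero hφ]
    exact (S.isDeligneFiltration_regularV φ).apply_mem (S.mem_formalV.1 hn φ hφ)

theorem pullbackEuler_mem_formalParabolic {b : ℝ} {n : Ram q ⊗[ConvLaurent] M}
    (hr : n ∈ S.regularPart) (hn : n ∈ S.formalParabolic b) :
    C.pullbackEuler q n ∈ S.formalParabolic b :=
  S.mem_formalParabolic_of_mem_regularPart (S.pullbackEuler_mem_regularPart hr)
    (S.pullbackEuler_mem_formalV (S.formalParabolic_le_formalV b hn))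

theorem mem_irregularPart_of_forall_mem_formalV [Module.Finite ConvLaurent M]
    {n : Ram q ⊗[ConvLaurent] M} (hn : ∀ k : ℕ, n ∈ S.formalV k) : n ∈ S.irregularPart :=
  S.mem_irregularPart.2 fun φ hφ => S.eq_zero_of_forall_mem_regularV φ 0 fun k => by
    rw [zero_add]
    exact S.mem_formalV.1 (hn k) φ hφ

end FormalFiltrations

/-! ### Irregularity and stable lattices -/

section Irregular

/-- Since `φ` has a pole, `y∂_y` lowers the `y`-adic order on `E^φ ⊗ R_φ`. -/
theorem zpow_smul_mem_of_mem_regularV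
    {W : Submodule (formalIntegers q) (Ram q ⊗[ConvLaurent] M)}
    (hstab : ∀ n ∈ W, C.pullbackEuler q n ∈ W) {φ : S.Φ} (hφ : (φ : Ram q) ≠ 0) {b : ℝ} {k : ℤ}
    (hk : ∀ s ∈ S.regularV φ b, Ram.y q ^ k • (s : Ram q ⊗[ConvLaurent] M) ∈ W) (j : ℕ) :
    ∀ s ∈ S.regularV φ b, Ram.y q ^ (k - j) • (s : Ram q ⊗[ConvLaurent] M) ∈ W := by
  obtain ⟨g, hg, hgφ⟩ := (S.polar φ φ.2).exists_mul_euler_eq_inv hφ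
  induction j with
  | zero => simpa using hk
  | succ j ih =>
    intro s hs
    set z : Ram q := Ram.y q ^ (k - j : ℤ)
    have euler_mem : z • (S.regularEuler φ s : Ram q ⊗[ConvLaurent] M) ∈ W :=
      ih _ ((S.isDeligneFiltration_regularV φ).apply_mem hs)
    have smul_mem (c : ℂ) : z • c • (s : Ram q ⊗[ConvLaurent] M) ∈ W := by
      rw [smul_comm, ← algebraMap_smul (formalIntegers q) c]
      exact W.smul_mem _ (ih s hs)
    have sum_mem := hstab _ (ih s hs)
    rw [(C.isEulerOperator_pullbackEuler q).apply_zpow_smul Ram.y_ne_zero, S.pullbackEuler_coe,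
      Submodule.coe_add, Submodule.coe_smul, smul_add, smul_add, add_right_comm] at sum_mem
    have polar_mem := (Submodule.add_mem_iff_right W (add_mem euler_mem (smul_mem _))).1 sum_mem
    have g_smul_mem := W.smul_mem (⟨g, hg⟩ : formalIntegers q) polar_mem
    change g • z • Ram.euler q φ • (s : Ram q ⊗[ConvLaurent] M) ∈ W at g_smul_mem
    rw [smul_comm g, smul_smul g, hgφ, smul_smul, ← zpow_neg_one,
      ← zpow_add₀ Ram.y_ne_zero] at g_smul_mem
    convert g_smul_mem using 3
    push_cast
    ring

theorem coe_mem_of_ne_zero {W : Submodule (formalIntegers q) (Ram q ⊗[ConvLaurent] M)}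
    (hW : Submodule.span (Ram q) (W : Set (Ram q ⊗[ConvLaurent] M)) = ⊤)
    (hstab : ∀ n ∈ W, C.pullbackEuler q n ∈ W) {φ : S.Φ} (hφ : (φ : Ram q) ≠ 0)
    (s : S.summand φ) : (s : Ram q ⊗[ConvLaurent] M) ∈ W := by
  obtain ⟨b, hb⟩ := (S.isDeligneFiltration_regularV φ).exhaustive s
  obtain ⟨k, hk⟩ := S.exists_regularV_le φ b hW
  obtain ⟨j, hj⟩ : ∃ j : ℕ, -(j : ℤ) ≤ k := ⟨(-k).toNat, by lia⟩
  have zpow_smul_mem (s : S.summand φ) (hs : s ∈ S.regularV φ b) :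
      Ram.y q ^ (j : ℤ) • (s : Ram q ⊗[ConvLaurent] M) ∈ W := by
    have hjs := zpowLattice_antitone (isUniformizer_formalIntegers q) W hj (hk s hs)
    rwa [mem_zpowLattice, neg_neg] at hjs
  simpa using S.zpow_smul_mem_of_mem_regularV hstab hφ zpow_smul_mem j s hb

theorem irregularPart_le {W : Submodule (formalIntegers q) (Ram q ⊗[ConvLaurent] M)}
    (hW : Submodule.span (Ram q) (W : Set (Ram q ⊗[ConvLaurent] M)) = ⊤)
    (hstab : ∀ n ∈ W, C.pullbackEuler q n ∈ W) {n : Ram q ⊗[ConvLaurent] M}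
    (hn : n ∈ S.irregularPart) : n ∈ W := by
  rw [← S.sum_component n]
  refine sum_mem fun φ _ => ?_
  by_cases hφ : (φ : Ram q) = 0
  · rw [S.mem_irregularPart.1 hn φ hφ]
    exact zero_mem _
  · exact S.coe_mem_of_ne_zero hW hstab hφ _

theorem mem_regularPart_of_bounded [Module.Finite ConvLaurent M]
    {X : Set (Ram q ⊗[ConvLaurent] M)} (hX : ∀ n ∈ X, C.pullbackEuler q n ∈ X) {b : ℝ}
    (hb : X ⊆ S.formalParabolic b) : X ⊆ S.regularPart := by
  refine fun n hn => S.mem_regularPart.2 fun φ hφ => ?_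
  obtain ⟨g, hg, hgφ⟩ := (S.polar φ φ.2).exists_mul_euler_eq_inv hφ
  have hV := S.isDeligneFiltration_regularV φ
  have component_mem (k : ℕ) : ∀ n ∈ X, S.component φ n ∈ S.regularV φ (b + k) := by
    induction k with
    | zero => simpa using fun n hn => S.mem_formalParabolic.1 (hb hn) φ
    | succ k ih =>
      intro n hn
      have sum_mem := ih _ (hX n hn)
      rw [component_pullbackEuler] at sum_mem
      have polar_mem :=
        (Submodule.add_mem_iff_right (M := S.summand φ) _ (hV.apply_mem (ih n hn))).1 sum_mem
      have inv_smul_mem := hV.smul_mem hg polar_mem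
      rw [smul_smul, hgφ, ← zpow_neg_one, ← S.zpow_smul_mem_regularV φ 1, smul_smul,
        ← zpow_add₀ Ram.y_ne_zero] at inv_smul_mem
      simpa [add_assoc] using inv_smul_mem
  exact S.eq_zero_of_forall_mem_regularV φ b fun k => component_mem k n hn

end Irregular

/-! ### The canonical parabolic filtration and the Deligne filtration of `M` -/

section Parabolic

theorem mem_parabolic {b : ℝ} {m : M} :
    m ∈ S.parabolic b ↔ unitMap q M m ∈ S.formalParabolic (q * b) := Iff.rfl

theorem smul_mem_parabolic {b : ℝ} {a : ConvLaurent} (ha : a ∈ convIntegers) {m : M}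
    (hm : m ∈ S.parabolic b) : a • m ∈ S.parabolic b := by
  rw [mem_parabolic, unitMap_smul]
  exact S.smul_mem_formalParabolic (Ram.algebraMap_mem_formalIntegers.2 ha) hm

theorem exists_zpow_smul_mem_parabolic (b : ℝ) (m : M) :
    ∃ k : ℤ, ConvLaurent.x ^ k • m ∈ S.parabolic b := by
  obtain ⟨k, hk⟩ := S.exists_zpow_smul_mem_formalParabolic (q * b) (unitMap q M m)
  exact ⟨k, by rwa [mem_parabolic, unitMap_x_zpow_smul]⟩

/-- The elements of `M` whose component in the regular part `R_0` belongs to `V^{qb} R_0`; this is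
the Deligne filtration of `M`. -/
def meromorphicV (b : ℝ) : Submodule ℂ M :=
  (S.formalV (q * b)).comap ((unitMap q M).restrictScalars ℂ)

theorem mem_meromorphicV {b : ℝ} {m : M} :
    m ∈ S.meromorphicV b ↔ unitMap q M m ∈ S.formalV (q * b) := Iff.rfl

theorem parabolic_le_meromorphicV (b : ℝ) : S.parabolic b ≤ S.meromorphicV b := fun _ hm =>
  S.formalParabolic_le_formalV _ hm

theorem euler_mem_meromorphicV {b : ℝ} {m : M} (hm : m ∈ S.meromorphicV b) :
    C.euler m ∈ S.meromorphicV b := by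
  have hmem := S.pullbackEuler_mem_formalV (S.mem_meromorphicV.1 hm)
  rw [pullbackEuler_unitMap] at hmem
  exact ((S.formalV (q * b)).smul_mem_iff (by exact_mod_cast q.ne_zero)).1 hmem

theorem generated_parabolic_le (b : ℝ) :
    generated convIntegers C.euler (S.parabolic b : Set M) ≤ S.meromorphicV b := by
  refine generated_le (S.parabolic_le_meromorphicV b) (fun a ha m hm => ?_)
    (fun m => S.euler_mem_meromorphicV)
  rw [mem_meromorphicV, unitMap_smul]
  exact S.smul_mem_formalV (Ram.algebraMap_mem_formalIntegers.2 ha) hm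

theorem formalSpan_generated_parabolic_le {b : ℝ} {n : Ram q ⊗[ConvLaurent] M}
    (hn : n ∈ formalSpan q (generated convIntegers C.euler (S.parabolic b : Set M))) :
    n ∈ S.formalV (q * b) := by
  induction hn using Submodule.closure_induction with
  | zero => exact zero_mem _
  | add _ _ _ _ hx hy => exact add_mem hx hy
  | smul_mem a n hn =>
    obtain ⟨m, hm, rfl⟩ := hn
    exact S.smul_mem_formalV a.2 (S.generated_parabolic_le b hm)

theorem irregularPart_le_formalSpan_generated_parabolic (b : ℝ) {n : Ram q ⊗[ConvLaurent] M}
    (hn : n ∈ S.irregularPart) :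
    n ∈ formalSpan q (generated convIntegers C.euler (S.parabolic b : Set M)) :=
  S.irregularPart_le
    (span_formalSpan fun m =>
      (S.exists_zpow_smul_mem_parabolic b m).imp fun _ hk => subset_generated _ _ hk)
    (fun _ => pullbackEuler_mem_formalSpan fun _ => apply_mem_generated) hn

/-- The coefficients of an invariant section can be truncated, so that it is approximated by
sections in `U`. -/
theorem exists_invariantProj_sub_mem {U : Submodule ℂ M}
    (hU : ∀ a ∈ convIntegers, ∀ m ∈ U, a • m ∈ U) (b : ℝ) {n : Ram q ⊗[ConvLaurent] M}
    (hn : n ∈ formalSpan q U) :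
    ∃ u ∈ U, invariantProj q M n - unitMap q M u ∈ S.formalParabolic b := by
  induction hn using Submodule.closure_induction with
  | zero => exact ⟨0, zero_mem _, by simp⟩
  | add x y _ _ hx hy =>
    obtain ⟨u, hu, hxu⟩ := hx
    obtain ⟨v, hv, hyv⟩ := hy
    refine ⟨u + v, add_mem hu hv, ?_⟩
    rw [map_add, map_add, add_sub_add_comm]
    exact add_mem hxu hyv
  | smul_mem g n hn =>
    obtain ⟨m, hm, rfl⟩ := hn
    obtain ⟨k, hk⟩ := S.exists_zpow_smul_mem_formalParabolic b (unitMap q M m)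
    obtain ⟨a, ha, hag⟩ := Ram.exists_zpow_mul_proj_sub_mem g.2 k
    refine ⟨a • m, hU a ha m hm, ?_⟩
    have hmem := S.smul_mem_formalParabolic hag hk
    rw [smul_smul, mul_comm, ← mul_assoc, ← zpow_add₀ Ram.y_ne_zero, add_neg_cancel, zpow_zero,
      one_mul, sub_smul] at hmem
    rw [unitMap_smul]
    change invariantProj q M ((g : Ram q) • unitMap q M m) - _ ∈ _
    rwa [invariantProj_smul_unitMap]

theorem exists_formalParabolic_le_basisLattice {ι : Type*}
    (B : Module.Basis ι ConvLaurent M) (b : ℝ) :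
    ∃ k : ℤ, S.formalParabolic b ≤ zpowLattice (Ram.y q) (basisLattice B q) ((q : ℕ) * k) := by
  choose f hf using fun φ => S.exists_regularV_le φ b (span_basisLattice B)
  obtain ⟨k, hk⟩ := (Set.finite_range f).bddBelow
  refine ⟨-(k.natAbs : ℤ), fun n hn => ?_⟩
  rw [← S.sum_component n]
  refine sum_mem fun φ _ => zpowLattice_antitone (isUniformizer_formalIntegers q) _ ?_
    (hf φ _ (S.mem_formalParabolic.1 hn φ))
  have le_mul : (k.natAbs : ℤ) ≤ (q : ℕ) * k.natAbs :=
    le_mul_of_one_le_left (Int.natCast_nonneg _) (by exact_mod_cast q.pos)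
  have le_f := hk ⟨φ, rfl⟩
  rw [mul_neg]
  lia

theorem exists_basisLattice_le_formalParabolic {ι : Type*} [Finite ι]
    (B : Module.Basis ι ConvLaurent M) (k : ℤ) :
    ∃ b : ℝ, zpowLattice (Ram.y q) (basisLattice B q) k ≤ S.formalParabolic b := by
  have := Fintype.ofFinite ι
  choose f hf using fun i => S.exists_mem_formalParabolic (B.baseChange (Ram q) i)
  obtain ⟨b, hb⟩ := (Set.finite_range f).bddBelow
  refine ⟨b + k, fun n hn => ?_⟩
  have hmem : Ram.y q ^ (-k) • n ∈ S.formalParabolic b := by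
    rw [← (B.baseChange (Ram q)).sum_repr (Ram.y q ^ (-k) • n)]
    exact sum_mem fun i _ => S.smul_mem_formalParabolic (hn i)
      (S.formalParabolic_antitone (hb ⟨i, rfl⟩) (hf i))
  rw [← S.zpow_smul_mem_formalParabolic k, smul_smul, ← zpow_add₀ Ram.y_ne_zero] at hmem
  simpa using hmem

variable [Module.Finite ConvLaurent M]

theorem invariantProj_mem_regularPart {n : Ram q ⊗[ConvLaurent] M} (hn : n ∈ S.regularPart) :
    invariantProj q M n ∈ S.regularPart := by
  obtain ⟨b, hb⟩ := S.exists_mem_formalParabolic n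
  let B := Module.finBasis ConvLaurent M
  obtain ⟨k, hk⟩ := S.exists_formalParabolic_le_basisLattice B b
  obtain ⟨c, hc⟩ := S.exists_basisLattice_le_formalParabolic B ((q : ℕ) * k)
  refine S.mem_regularPart_of_bounded (b := c)
    (X := invariantProj q M '' {n | n ∈ S.regularPart ∧ n ∈ S.formalParabolic b}) ?_ ?_
    ⟨n, ⟨hn, hb⟩, rfl⟩
  · rintro _ ⟨n, ⟨hr, hn⟩, rfl⟩
    exact ⟨C.pullbackEuler q n, ⟨S.pullbackEuler_mem_regularPart hr,
      S.pullbackEuler_mem_formalParabolic hr hn⟩, C.invariantProj_pullbackEuler n⟩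
  · rintro _ ⟨n, ⟨-, hn⟩, rfl⟩
    exact hc (invariantProj_mem_zpowLattice_basisLattice B (hk hn))

theorem invariantProj_mem_irregularPart {n : Ram q ⊗[ConvLaurent] M}
    (hn : n ∈ S.irregularPart) : invariantProj q M n ∈ S.irregularPart := by
  refine S.mem_irregularPart_of_forall_mem_formalV fun k => ?_
  have hmem := S.formalSpan_generated_parabolic_le (invariantProj_mem_formalSpan
    (S.irregularPart_le_formalSpan_generated_parabolic (b := k / q) hn))
  rwa [mul_div_cancel₀ _ (by exact_mod_cast q.ne_zero)] at hmem

theorem generated_parabolic (b : ℝ) :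
    generated convIntegers C.euler (S.parabolic b : Set M) = S.meromorphicV b := by
  refine le_antisymm (S.generated_parabolic_le b) fun m hm => ?_
  obtain ⟨r, hr, i, hi, hri⟩ := S.exists_regular_add_irregular (unitMap q M m)
  have proj_add_proj : invariantProj q M r + invariantProj q M i = unitMap q M m := by
    rw [← map_add, hri, invariantProj_unitMap]
  have proj_regular : invariantProj q M r ∈ S.formalParabolic (q * b) := by
    refine S.mem_formalParabolic_of_mem_regularPart (S.invariantProj_mem_regularPart hr) ?_
    rw [eq_sub_of_add_eq proj_add_proj]
    exact sub_mem hm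
      (S.mem_formalV_of_mem_irregularPart (S.invariantProj_mem_irregularPart hi) _)
  obtain ⟨u, hu, hiu⟩ := S.exists_invariantProj_sub_mem (fun a ha m => smul_mem_generated ha)
    (q * b) (S.irregularPart_le_formalSpan_generated_parabolic b hi)
  have sub_mem_parabolic : m - u ∈ S.parabolic b := by
    rw [mem_parabolic, map_sub, ← proj_add_proj, add_sub_assoc]
    exact add_mem proj_regular hiu
  rw [← sub_add_cancel m u]
  exact add_mem (subset_generated _ _ sub_mem_parabolic) hu

theorem exists_parabolic_coe_eq_span (b : ℝ) :
    ∃ T : Finset M, (S.parabolic b : Set M) = Submodule.span convIntegers (T : Set M) := by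
  let B := Module.finBasis ConvLaurent M
  obtain ⟨k, hk⟩ := S.exists_formalParabolic_le_basisLattice B (q * b)
  exact exists_finset_coe_eq_span ConvLaurent.x_ne_zero (Submodule.fg_span (Set.finite_range B))
    (fun a ha m => S.smul_mem_parabolic ha)
    fun m hm => mem_zpowLattice_span_range_of_unitMap_mem B (hk hm)

theorem exists_meromorphicV_eq_generated (b : ℝ) :
    ∃ T : Finset M, S.meromorphicV b = generated convIntegers C.euler (T : Set M) := by
  obtain ⟨T, hT⟩ := S.exists_parabolic_coe_eq_span b
  exact ⟨T, by rw [← S.generated_parabolic, generated_eq_generated_of_coe_eq_span _ hT]⟩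

theorem isDeligneFiltration_meromorphicV :
    IsDeligneFiltration convIntegers ConvLaurent.x C.euler S.meromorphicV := by
  have hfin := S.exists_meromorphicV_eq_generated
  by_cases hΦ : ∃ φ : S.Φ, (φ : Ram q) = 0
  · obtain ⟨φ, hφ⟩ := hΦ
    let ρ : M →ₗ[ℂ] S.summand φ :=
      (S.component φ).restrictScalars ℂ ∘ₗ (unitMap q M).restrictScalars ℂ
    have meromorphicV_eq : S.meromorphicV = fun b => (S.regularV φ (q * b)).comap ρ := by
      ext b m
      rw [mem_meromorphicV, mem_formalV]
      refine ⟨fun h => h φ hφ, fun h ψ hψ => ?_⟩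
      obtain rfl : ψ = φ := Subtype.ext (hψ.trans hφ.symm)
      exact h
    have map_x_smul (m : M) : ρ (ConvLaurent.x • m) = Ram.y q ^ (q : ℕ) • ρ m := by
      have unitMap_x_smul := unitMap_x_zpow_smul (q := q) 1 m
      rw [zpow_one, mul_one, zpow_natCast] at unitMap_x_smul
      exact (congrArg (S.component φ) unitMap_x_smul).trans (map_smul (S.component φ) _ _)
    have euler_map (m : M) : S.regularEuler φ (ρ m) = ((q : ℕ) : ℂ) • ρ (C.euler m) := by
      refine (S.component_pullbackEuler_of_eq_zero hφ _).symm.trans ?_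
      exact (congrArg (S.component φ) (C.pullbackEuler_unitMap m)).trans
        (map_smul ((S.component φ).restrictScalars ℂ) _ _)
    rw [meromorphicV_eq] at hfin ⊢
    exact (S.isDeligneFiltration_regularV φ).comap_mul Ram.y_ne_zero ConvLaurent.x_ne_zero
      map_x_smul euler_map hfin
  · have meromorphicV_eq : S.meromorphicV = fun _ => ⊤ :=
      funext fun b => eq_top_iff.2 fun m _ => S.mem_formalV.2 fun φ hφ => absurd ⟨φ, hφ⟩ hΦ
    rw [meromorphicV_eq] at hfin ⊢
    exact IsDeligneFiltration.top ConvLaurent.x_ne_zero (hfin 0)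

theorem V_eq_meromorphicV : C.V = S.meromorphicV :=
  S.isDeligneFiltration_meromorphicV.deligne_eq

end Parabolic

end ElementaryModel

end Connection

end MeroConn

end

theorem mainTheorem5 {M : Type*} [AddCommGroup M] [Module ℂ M] [Module MeroConn.ConvLaurent M]
    [IsScalarTower ℂ MeroConn.ConvLaurent M] [Module.Finite MeroConn.ConvLaurent M]
    (C : MeroConn.Connection M) (q : ℕ+) (S : C.ElementaryModel q) :
    C.minimalExtension = C.DSpan (MeroConn.above S.parabolic (-1)) := by
  rw [MeroConn.Connection.minimalExtension, S.V_eq_meromorphicV]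
  refine le_antisymm ?_
    (MeroConn.generated_mono (MeroConn.above_mono S.parabolic_le_meromorphicV (-1)))
  set N := C.DSpan (MeroConn.above S.parabolic (-1))
  have smul_mem : ∀ a ∈ MeroConn.convIntegers, ∀ m ∈ N, a • m ∈ N := fun _ ha _ =>
    MeroConn.smul_mem_generated ha
  have d_mem : ∀ m ∈ N, C.d m ∈ N := fun _ => MeroConn.apply_mem_generated
  have meromorphicV_le : ∀ b > (-1 : ℝ), S.meromorphicV b ≤ N := fun b hb => by
    rw [← S.generated_parabolic]
    exact MeroConn.generated_le
      (fun m hm => MeroConn.subset_generated _ _ (MeroConn.le_above _ hb hm)) smul_mem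
      fun m hm => smul_mem _ MeroConn.ConvLaurent.x_mem _ (d_mem m hm)
  exact MeroConn.generated_le (MeroConn.above_le meromorphicV_le) smul_mem d_mem
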